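/- \textbf{Setting.} Let $(X,\rho)$ be a quasi-metric space: $\rho:X\times X\to[0,\infty)$ is symmetric, vanishes exactly on the diagonal, and $\rho(x,y)\le A_0(\rho(x,z)+\rho(z,y))$ for some $A_0\ge 1$. Put $B(x,r)=\{y:\rho(x,y)<r\}$; a set is open if it contains a ball of positive radius around each of its points. Assume that $X$ is geometrically doubling: for some $A_1\in\mathbb N$ every ball of radius $r>0$ is covered by at most $A_1$ balls of radius $r/2$. Let $\mu$ be a Borel measure on $X$ with $\mu(B)<\infty$ for all balls $B$. Let $\mathscr D=\bigcup_{k\in\mathbb Z}\mathscr D_k$, $\mathscr D_k=\{Q^k_\alpha:\alpha\in\mathscr A_k\}$ with $\mathscr A_k$ countable, be a system of dyadic cubes with parameters $\delta\in(0,1)$, $0<c_1\le C_1<\infty$ and center points $x^k_\alpha$. That is, the $Q^k_\alpha$ are Borel sets such that: for each $k$, $X$ is the disjoint union of the $Q^k_\alpha$; if $\ell\ge k$ then $Q^\ell_\beta\subseteq Q^k_\alpha$ or $Q^\ell_\beta\cap Q^k_\alpha=\emptyset$; for each $(k,\alpha)$ and $\ell\le k$ there is a unique $\beta$ with $Q^k_\alpha\subseteq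 Q^\ell_\beta$; each $Q^k_\alpha$ is the union of its children, the cubes $Q^{k+1}_\beta\subseteq Q^k_\alpha$, whose number $M_Q$ (for $Q=Q^k_\alpha$) is at least $1$ and bounded uniformly in $(k,\alpha)$; $B(x^k_\alpha,c_1\delta^k)\subseteq Q^k_\alpha\subseteq B(x^k_\alpha,C_1\delta^k)$; and if $\ell\ge k$ and $Q^\ell_\beta\subseteq Q^k_\alpha$, then $B(x^\ell_\beta,C_1\delta^\ell)\subseteq B(x^k_\alpha,C_1\delta^k)$. Cubes are labelled by their index $(k,\alpha)$. Assume that the system has a distinguished center point: some $x_0\in X$ is the center of a cube of $\mathscr D_k$ for every $k\in\mathbb Z$. For each cube $Q$ let $Q_1,\dots,Q_{M_Q}$ be an enumeration of its children such that $\sum_{j=u}^{M_Q}\mu(Q_j)\ge\bigl(1-\tfrac{u-1}{M_Q}\bigr)\mu(Q)$ for $u=1,\dots,M_Q$. Put $E_u=\bigcup_{j=u}^{M_Q}Q_j$, $h^Q_0=\mu(Q)^{-1/2}1_Q$ (read as $0$ if $\mu(Q)=0$), and for $u=1,\dots,M_Q-1$ put $h^Q_u=0$ if $\mu(Q_u)=0$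 and otherwise \[ h^Q_u=\frac{\mu(E_{u+1})^{1/2}}{\mu(Q_u)^{1/2}\mu(E_u)^{1/2}}\,1_{Q_u}-\frac{\mu(Q_u)^{1/2}}{\mu(E_u)^{1/2}\mu(E_{u+1})^{1/2}}\,1_{E_{u+1}} . \] Write $\langle f,h\rangle=\int_X f h\,d\mu$, and let $m_X(f)=\frac1{\mu(X)}\int_X f\,d\mu$ if $\mu(X)<\infty$ (read as $0$ if $\mu(X)=0$) and $m_X(f)=0$ if $\mu(X)=\infty$. For fixed $k$ and $x$, in the sums over $Q\in\mathscr D_k$ below only the cube containing $x$ contributes. \textbf{Theorem.} Let $1<p<\infty$ and $f\in L^p(X,\mu)$, real- or complex-valued. (a) $f=m_X(f)+\sum_{Q\in\mathscr D}\sum_{u=1}^{M_Q-1}\langle f,h^Q_u\rangle h^Q_u$, where the sum over all pairs $(Q,u)$ converges unconditionally in the $L^p(X,\mu)$-norm, and converges pointwise $\mu$-a.e. when summed by generations: for $\mu$-a.e. $x$, \[ m_X(f)+\sum_{k=m}^{n-1}\sum_{Q\in\mathscr D_k}\sum_{u=1}^{M_Q-1}\langle f,h^Q_u\rangle h^Q_u(x)\longrightarrow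 f(x)\qquad\text{as } m\to-\infty,\ n\to+\infty \text{ independently.} \] (b) For every $m\in\mathbb Z$, \[ f=\sum_{k\ge m}\sum_{Q\in\mathscr D_k}\sum_{u=1}^{M_Q-1}\langle f,h^Q_u\rangle h^Q_u+\sum_{Q\in\mathscr D_m}\langle f,h^Q_0\rangle h^Q_0 , \] where the first sum converges unconditionally in the $L^p(X,\mu)$-norm, and, summed in the order of increasing $k$, pointwise $\mu$-a.e. (c) As $m\to-\infty$, $\sum_{Q\in\mathscr D_m}\langle f,h^Q_0\rangle h^Q_0\to m_X(f)$, at every point of $X$ and in the $L^p(X,\mu)$-norm. -/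

import Mathlib

open MeasureTheory Filter Topology
open scoped ENNReal

noncomputable section

/-- A quasi-metric space with the topology induced by the quasi-metric: a set is open iff it
contains a ball around each of its points (balls themselves need not be open). -/
class QuasiMetricSpace (X : Type*) extends TopologicalSpace X where
  qdist : X → X → ℝ
  qdist_nonneg : ∀ x y, 0 ≤ qdist x y
  qdist_eq_zero_iff : ∀ x y, qdist x y = 0 ↔ x = y
  qdist_comm : ∀ x y, qdist x y = qdist y x
  exists_quasi_triangle :
    ∃ A₀ : ℝ, 1 ≤ A₀ ∧ ∀ x y z, qdist x y ≤ A₀ * (qdist x z + qdist z y)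
  isOpen_iff_qball : ∀ Ω : Set X,
    IsOpen Ω ↔ ∀ x ∈ Ω, ∃ ε : ℝ, 0 < ε ∧ {y | qdist x y < ε} ⊆ Ω

/-- The ball `B(x, r) = {y | ρ(x, y) < r}`. -/
def qball {X : Type*} [QuasiMetricSpace X] (x : X) (r : ℝ) : Set X :=
  {y | QuasiMetricSpace.qdist x y < r}

/-- Every ball of radius `r > 0` is covered by at most `A₁` balls of radius `r / 2`. -/
def GeometricallyDoubling (X : Type*) [QuasiMetricSpace X] : Prop :=
  ∃ A₁ : ℕ, 0 < A₁ ∧ ∀ (x : X) (r : ℝ), 0 < r →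
    ∃ s : Finset X, s.card ≤ A₁ ∧ qball x r ⊆ ⋃ y ∈ s, qball y (r / 2)

/-- A system of dyadic cubes with parameters `δ`, `c₁`, `C₁`: `A k` indexes the cubes of
generation `k`, `cube k α` is the cube and `center k α` its center point. -/
structure DyadicSystem (X : Type*) [QuasiMetricSpace X] [MeasurableSpace X] where
  δ : ℝ
  δ_pos : 0 < δ
  δ_lt_one : δ < 1
  c₁ : ℝ
  C₁ : ℝ
  c₁_pos : 0 < c₁
  c₁_le_C₁ : c₁ ≤ C₁
  A : ℤ → Type
  countable_A : ∀ k, Countable (A k)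
  cube : ∀ k : ℤ, A k → Set X
  center : ∀ k : ℤ, A k → X
  measurableSet_cube : ∀ k α, MeasurableSet (cube k α)
  cover : ∀ k, ⋃ α, cube k α = Set.univ
  disjoint : ∀ k (α β : A k), α ≠ β → Disjoint (cube k α) (cube k β)
  nested : ∀ (k l : ℤ) (α : A k) (β : A l), k ≤ l →
    cube l β ⊆ cube k α ∨ Disjoint (cube k α) (cube l β)
  parent : ∀ (k l : ℤ) (α : A k), l ≤ k → ∃! β : A l, cube k α ⊆ cube l β
  /-- A uniform bound for the number of children. -/
  M : ℕ
  children_card : ∀ (k : ℤ) (α : A k),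
    1 ≤ {β : A (k + 1) | cube (k + 1) β ⊆ cube k α}.encard ∧
      {β : A (k + 1) | cube (k + 1) β ⊆ cube k α}.encard ≤ M
  children_union : ∀ (k : ℤ) (α : A k),
    cube k α = ⋃ β ∈ {β : A (k + 1) | cube (k + 1) β ⊆ cube k α}, cube (k + 1) β
  qball_subset_cube : ∀ (k : ℤ) (α : A k), qball (center k α) (c₁ * δ ^ k) ⊆ cube k α
  cube_subset_qball : ∀ (k : ℤ) (α : A k), cube k α ⊆ qball (center k α) (C₁ * δ ^ k)
  monotone_qball : ∀ (k l : ℤ) (α : A k) (β : A l), k ≤ l → cube l β ⊆ cube k α →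
    qball (center l β) (C₁ * δ ^ l) ⊆ qball (center k α) (C₁ * δ ^ k)

namespace DyadicSystem

variable {X : Type*} [QuasiMetricSpace X] [MeasurableSpace X]

/-- The distinguished center point property: some point is a center in every generation. -/
def HasDistinguishedCenter (D : DyadicSystem X) : Prop :=
  ∃ x₀ : X, ∀ k : ℤ, ∃ α : D.A k, D.center k α = x₀

/-- The children of the cube `(k, α)`. -/
def Child (D : DyadicSystem X) (k : ℤ) (α : D.A k) : Type :=
  {β : D.A (k + 1) // D.cube (k + 1) β ⊆ D.cube k α}

/-- The number `M_Q` of children of the cube `Q = (k, α)`. -/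
def numChildren (D : DyadicSystem X) (k : ℤ) (α : D.A k) : ℕ :=
  Nat.card (D.Child k α)

/-- An admissible indexing of the children of every cube `Q`: an enumeration `Q_0, …, Q_{M_Q - 1}`
(counted from `0`) such that
`∑_{j ≥ u} μ(Q_j) ≥ (1 - u / M_Q) μ(Q)` for every `u = 0, …, M_Q - 1`. -/
structure ChildIndexing (D : DyadicSystem X) (μ : Measure X) where
  enum : ∀ (k : ℤ) (α : D.A k), Fin (D.numChildren k α) ≃ D.Child k α
  tail_ge : ∀ (k : ℤ) (α : D.A k) (u : Fin (D.numChildren k α)),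
    (1 - (u : ℝ) / (D.numChildren k α : ℝ)) * μ.real (D.cube k α) ≤
      ∑ j ∈ Finset.univ.filter (fun j => u ≤ j), μ.real (D.cube (k + 1) (enum k α j).1)

/-- The non-cancellative Haar function `h^Q_0 = μ(Q)^{-1/2} 1_Q`
(which is `0` if `μ(Q) = 0`, as `0⁻¹ = 0`). -/
def haarZero (D : DyadicSystem X) (μ : Measure X) (k : ℤ) (α : D.A k) : X → ℝ :=
  (D.cube k α).indicator fun _ => (Real.sqrt (μ.real (D.cube k α)))⁻¹

namespace ChildIndexing

variable {D : DyadicSystem X} {μ : Measure X}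

/-- The child with number `j` (counted from `0`) of the cube `(k, α)`. -/
def subcube (I : D.ChildIndexing μ) (k : ℤ) (α : D.A k) (j : Fin (D.numChildren k α)) : Set X :=
  D.cube (k + 1) (I.enum k α j).1

/-- The union `E_u` of the children with number at least `u` (counted from `0`). -/
def tail (I : D.ChildIndexing μ) (k : ℤ) (α : D.A k) (u : ℕ) : Set X :=
  ⋃ (j : Fin (D.numChildren k α)) (_ : u ≤ (j : ℕ)), I.subcube k α j

open Classical in
/-- The cancellative Haar functions of the cube `Q = (k, α)`, numbered `u = 0, …, M_Q - 2`:
`0` if `μ(Q_u) = 0`, and otherwise `a 1_{Q_u} - b 1_{E_{u+1}}` with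
`a = μ(E_{u+1})^{1/2} / (μ(Q_u)^{1/2} μ(E_u)^{1/2})` and
`b = μ(Q_u)^{1/2} / (μ(E_u)^{1/2} μ(E_{u+1})^{1/2})`. -/
def haar (I : D.ChildIndexing μ) (k : ℤ) (α : D.A k) (u : Fin (D.numChildren k α - 1)) :
    X → ℝ := fun x =>
  let Qu : Set X := I.subcube k α ⟨u, by omega⟩
  let Eu : Set X := I.tail k α u
  let Eu' : Set X := I.tail k α (u + 1)
  if μ Qu = 0 then 0
  else
    Real.sqrt (μ.real Eu') / (Real.sqrt (μ.real Qu) * Real.sqrt (μ.real Eu)) *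
        Qu.indicator (fun _ => (1 : ℝ)) x
      - Real.sqrt (μ.real Qu) / (Real.sqrt (μ.real Eu) * Real.sqrt (μ.real Eu')) *
        Eu'.indicator (fun _ => (1 : ℝ)) x

end ChildIndexing

/-- The index set of all cancellative Haar functions: generation, cube, number. -/
abbrev HaarIndex (D : DyadicSystem X) : Type :=
  (k : ℤ) × (α : D.A k) × Fin (D.numChildren k α - 1)

end DyadicSystem

/-- The pairing `⟨f, h⟩ = ∫ f h dμ` with a real function `h`. -/
def pairing {X 𝕜 : Type*} [MeasurableSpace X] [RCLike 𝕜] (μ : Measure X)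
    (f : X → 𝕜) (h : X → ℝ) : 𝕜 :=
  ∫ x, f x * (h x : 𝕜) ∂μ

open Classical in
/-- `m_X(f)`: the mean of `f` if `μ(X) < ∞`, and `0` if `μ(X) = ∞`. -/
def globalMean {X 𝕜 : Type*} [MeasurableSpace X] [RCLike 𝕜] (μ : Measure X) (f : X → 𝕜) : 𝕜 :=
  if μ Set.univ < ∞ then ((μ.real Set.univ)⁻¹ : ℝ) * ∫ x, f x ∂μ else 0

namespace DyadicSystem

variable {X 𝕜 : Type*} [QuasiMetricSpace X] [MeasurableSpace X] [RCLike 𝕜]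
  {D : DyadicSystem X} {μ : Measure X}

/-- The term `⟨f, h⟩ h(x)` of the Haar expansion for the index `i = (k, α, u)`. -/
def ChildIndexing.haarTerm (I : D.ChildIndexing μ) (f : X → 𝕜) (i : D.HaarIndex) (x : X) : 𝕜 :=
  pairing μ f (I.haar i.1 i.2.1 i.2.2) * (I.haar i.1 i.2.1 i.2.2 x : 𝕜)

/-- `∑_{Q ∈ D_k} ∑_u ⟨f, h^Q_u⟩ h^Q_u(x)`, over the cubes of generation `k`; for each `x` only the
cube that contains `x` contributes. -/
def ChildIndexing.generationSum (I : D.ChildIndexing μ) (f : X → 𝕜) (k : ℤ) (x : X) : 𝕜 :=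
  ∑' α : D.A k, ∑ u : Fin (D.numChildren k α - 1), I.haarTerm f ⟨k, α, u⟩ x

/-- `∑_{Q ∈ D_m} ⟨f, h^Q_0⟩ h^Q_0(x)`; for each `x` only the cube that contains `x` contributes. -/
def averageSum (D : DyadicSystem X) (μ : Measure X) (f : X → 𝕜) (m : ℤ) (x : X) : 𝕜 :=
  ∑' α : D.A m, pairing μ f (D.haarZero μ m α) * (D.haarZero μ m α x : 𝕜)

/-- Only the cube containing `x` contributes to `generationSum`. -/
theorem ChildIndexing.haarTerm_eq_zero (I : D.ChildIndexing μ) (f : X → 𝕜) (i : D.HaarIndex)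
    {x : X} (hx : x ∉ D.cube i.1 i.2.1) : I.haarTerm f i x = 0 := by
  have h1 : ∀ j, x ∉ I.subcube i.1 i.2.1 j := fun j h => hx ((I.enum i.1 i.2.1 j).2 h)
  have h2 : ∀ u, x ∉ I.tail i.1 i.2.1 u := by
    intro u h
    simp only [ChildIndexing.tail, Set.mem_iUnion] at h
    obtain ⟨j, _, hj⟩ := h
    exact h1 j hj
  simp [haarTerm, haar, h1, h2]

/-- The family summed in `generationSum` has finite support. -/
theorem ChildIndexing.summable_generation (I : D.ChildIndexing μ) (f : X → 𝕜) (k : ℤ) (x : X) :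
    Summable fun α : D.A k => ∑ u : Fin (D.numChildren k α - 1), I.haarTerm f ⟨k, α, u⟩ x := by
  obtain ⟨α, hα⟩ : ∃ α, x ∈ D.cube k α := by
    have := D.cover k ▸ Set.mem_univ x
    simpa using this
  refine summable_of_ne_finset_zero (s := {α}) fun β hβ => Finset.sum_eq_zero fun u _ => ?_
  refine I.haarTerm_eq_zero f ⟨k, β, u⟩ fun hx => ?_
  exact Set.disjoint_left.1 (D.disjoint k β α (by simpa using hβ)) hx hα

/-- The family summed in `averageSum` has finite support. -/
theorem summable_average (D : DyadicSystem X) (μ : Measure X) (f : X → 𝕜) (m : ℤ) (x : X) :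
    Summable fun α : D.A m =>
      pairing μ f (D.haarZero μ m α) * (D.haarZero μ m α x : 𝕜) := by
  obtain ⟨α, hα⟩ : ∃ α, x ∈ D.cube m α := by
    have := D.cover m ▸ Set.mem_univ x
    simpa using this
  refine summable_of_ne_finset_zero (s := {α}) fun β hβ => ?_
  have : x ∉ D.cube m β := fun hx =>
    Set.disjoint_left.1 (D.disjoint m β α (by simpa using hβ)) hx hα
  simp [haarZero, this]

end DyadicSystem

end

/-!
The averages `averageSum D μ f n` over the cubes of generation `n` form a martingale, and the
Haar terms are its differences along a finer scale: a cube is cut into its children by splitting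
off one child after the other, the `u`-th cut divides the tail `E_u` into `Q_u` and `E_{u+1}`, and
`⟨f, h_u⟩ h_u` is the difference of the averages before and after this cut
(`haarTerm_eq_increment`, outside the cubes of measure zero). Summed over the cuts of one
generation, these differences telescope to the difference of two consecutive averages
(`generationSum_eq_sub`). The pointwise statements therefore reduce to the behaviour of the
averages at both ends.

* For `n → +∞` the cubes generate the Borel `σ`-algebra, and on each cube of generation `0` Lévy's
  upward theorem gives convergence to `f` almost everywhere (`ae_tendsto_averageSum_atTop`).
  Convergence in norm follows by approximation with bounded functions supported in a cube.
* For `m → -∞` the cubes around the distinguished center exhaust the space, so that every point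
  eventually sees the averages over these cubes. They tend to the global mean; if the measure is
  infinite, they tend to `0` by Hölder's inequality. In norm one approximates `f` by a function
  supported in one cube and uses `p > 1`.

Unconditional convergence rests on a bound for arbitrary finite partial sums,
`‖∑_{i ∈ s} ⟨f, h_i⟩ h_i‖_p ≤ C_p ‖f‖_p` (`exists_eLpNorm_sum_haarTerm_le`). Such a sum is a
martingale transform with multipliers `0` and `1`, and the bound is Burkholder's. His function is
written in coordinates in which only one of the two arguments moves in each step: with `u` the
transform and `v` the average minus the transform, a step with multiplier `1` moves `u` and a step
with multiplier `0` moves `v`. The function `burkholderFun p u v` is concave in each variable,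
nonpositive for `u = 0`, and bounds `|u| ^ p` up to a multiple of `|u + v| ^ p`. Jensen's inequality
for each cut shows that its integral over a cube does not increase from one generation to the next
(`setIntegral_burkholderFun_le`), which gives the bound for real functions, and then for complex
ones by splitting off the real and imaginary parts.

With this bound, the terms of generation at least `n` contribute at most `C ‖f - A_n f‖_p`, those
of generation less than `m` at most `C ‖A_m f - m_X(f)‖_p`, where `A_n f` denotes the average, and
between the two, up to a small error, only the finitely many cubes inside one large cube matter
(`exists_finset_eLpNorm_averageSum_sub_le`).
-/

noncomputable section

/-! ### Burkholder's function -/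

/-- For fixed `v ≥ 0` the function `u ↦ burkholderFun p u v` is affine on `[-v, v]`. The branches
considered here are its deviations from this affine function, up to a constant, for `u ≥ v`
(with `τ = 1`, `w = u`) and for `u ≤ -v` (with `τ = -1`, `w = -u`). -/
theorem burkholder_branch {p v : ℝ} (hp : 1 < p) (hv : 0 ≤ v) {τ : ℝ} (hτ : τ = 1 ∨ τ = -1) :
    ConcaveOn ℝ (Set.Ici v) (fun w => (min 1 (p - 1) - p / 2) * w ^ p
      - τ * (p / 2) * v * w ^ (p - 1) + τ * (p / 2) * v ^ (p - 1) * w) ∧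
    AntitoneOn (fun w => (min 1 (p - 1) - p / 2) * w ^ p
      - τ * (p / 2) * v * w ^ (p - 1) + τ * (p / 2) * v ^ (p - 1) * w) (Set.Ici v) := by
  set c : ℝ := min 1 (p - 1) with hc
  have hc1 : c ≤ 1 := min_le_left _ _
  have hc2 : c ≤ p - 1 := min_le_right _ _
  have hcp : 2 * c - p ≤ p - 2 ∧ 2 * c - p ≤ 2 - p := ⟨by linarith, by linarith⟩
  set g : ℝ → ℝ := fun w => (c - p / 2) * w ^ p
      - τ * (p / 2) * v * w ^ (p - 1) + τ * (p / 2) * v ^ (p - 1) * w with hg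
  set d : ℝ → ℝ := fun w => p / 2 * ((2 * c - p) * w ^ (p - 1)
      - τ * (p - 1) * v * w ^ (p - 2) + τ * v ^ (p - 1)) with hd
  have hcont : ContinuousOn g (Set.Ici v) := by
    have h1 : Continuous fun w : ℝ => w ^ p := Real.continuous_rpow_const (by linarith)
    have h2 : Continuous fun w : ℝ => w ^ (p - 1) := Real.continuous_rpow_const (by linarith)
    exact (by fun_prop : Continuous g).continuousOn
  have hderiv : ∀ w : ℝ, 0 < w → HasDerivAt g (d w) w := by
    intro w hw
    have h1 := (Real.hasDerivAt_rpow_const (p := p) (Or.inl hw.ne')).const_mul (c - p / 2)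
    have h2 := (Real.hasDerivAt_rpow_const (p := p - 1) (Or.inl hw.ne')).const_mul
      (τ * (p / 2) * v)
    have h3 := (hasDerivAt_id w).const_mul (τ * (p / 2) * v ^ (p - 1))
    have h4 := (h1.sub h2).add h3
    refine h4.congr_deriv ?_
    rw [show p - 1 - 1 = p - 2 by ring]
    simp only [hd]; ring
  have hpos : ∀ w ∈ interior (Set.Ici v), 0 < w := by
    intro w hw; rw [interior_Ici] at hw; exact hv.trans_lt hw
  -- `d` is the derivative of `g`; it decreases, and it is nonpositive already at `v`
  have key : AntitoneOn d (Set.Ioi v) ∧ ∀ w ∈ Set.Ioi v, d w ≤ 0 := by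
    rcases hv.eq_or_lt with rfl | hv0
    · have e : ∀ w, d w = p / 2 * (2 * c - p) * w ^ (p - 1) := by
        intro w; simp only [hd, Real.zero_rpow (by linarith : p - 1 ≠ 0)]; ring
      have hk : p / 2 * (2 * c - p) ≤ 0 :=
        mul_nonpos_of_nonneg_of_nonpos (by linarith) (by linarith)
      refine ⟨fun a ha b hb hab => ?_, fun w hw => ?_⟩
      · rw [e, e]
        exact mul_le_mul_of_nonpos_left
          (Real.rpow_le_rpow (le_of_lt ha) hab (by linarith)) hk
      · rw [e]
        exact mul_nonpos_of_nonpos_of_nonneg hk (Real.rpow_nonneg (le_of_lt hw) _)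
    · have hdd : ∀ w : ℝ, 0 < w → HasDerivAt d (p / 2 * ((p - 1) * w ^ (p - 3) *
          ((2 * c - p) * w - τ * (p - 2) * v))) w := by
        intro w hw
        have h1 := (Real.hasDerivAt_rpow_const (p := p - 1) (Or.inl hw.ne')).const_mul
          (2 * c - p)
        have h2 := (Real.hasDerivAt_rpow_const (p := p - 2) (Or.inl hw.ne')).const_mul
          (τ * (p - 1) * v)
        have h4 := ((h1.sub h2).add_const (τ * v ^ (p - 1))).const_mul (p / 2)
        refine h4.congr_deriv ?_
        rw [show p - 2 - 1 = p - 3 by ring, show p - 1 - 1 = (p - 3) + 1 by ring,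
          Real.rpow_add_one hw.ne']
        ring
      have hanti : AntitoneOn d (Set.Ici v) := by
        refine antitoneOn_of_deriv_nonpos (convex_Ici v)
          (fun w hw => (hdd w (hv0.trans_le hw)).continuousAt.continuousWithinAt)
          (fun w hw => (hdd w (hpos w hw)).differentiableAt.differentiableWithinAt) ?_
        intro w hw
        rw [(hdd w (hpos w hw)).deriv]
        have hw0 := hpos w hw
        rw [interior_Ici] at hw
        have hvw : v ≤ w := le_of_lt hw
        refine mul_nonpos_of_nonneg_of_nonpos (by linarith)
          (mul_nonpos_of_nonneg_of_nonpos
            (mul_nonneg (by linarith) (Real.rpow_nonneg hw0.le _)) ?_)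
        rcases hτ with rfl | rfl <;> rcases le_total p 2 with h2 | h2 <;> nlinarith
      refine ⟨hanti.mono Set.Ioi_subset_Ici_self, fun w hw => ?_⟩
      refine (hanti Set.self_mem_Ici (Set.mem_Ici.2 (le_of_lt hw)) (le_of_lt hw)).trans ?_
      have e : d v = p / 2 * (v ^ (p - 1) * ((2 * c - p) - τ * (p - 1) + τ)) := by
        simp only [hd]
        rw [show p - 1 = (p - 2) + 1 by ring, Real.rpow_add_one hv0.ne']
        ring
      rw [e]
      refine mul_nonpos_of_nonneg_of_nonpos (by linarith)
        (mul_nonpos_of_nonneg_of_nonpos (Real.rpow_nonneg hv _) ?_)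
      rcases hτ with rfl | rfl <;> linarith
  constructor
  · refine AntitoneOn.concaveOn_of_deriv (convex_Ici v) hcont
      (fun w hw => (hderiv w (hpos w hw)).differentiableAt.differentiableWithinAt) ?_
    intro a ha b hb hab
    rw [(hderiv a (hpos a ha)).deriv, (hderiv b (hpos b hb)).deriv]
    rw [interior_Ici] at ha hb
    exact key.1 ha hb hab
  · refine antitoneOn_of_deriv_nonpos (convex_Ici v) hcont
      (fun w hw => (hderiv w (hpos w hw)).differentiableAt.differentiableWithinAt) ?_
    intro w hw
    rw [(hderiv w (hpos w hw)).deriv]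
    rw [interior_Ici] at hw
    exact key.2 w hw

/-- Burkholder's function for the exponent `p`, up to normalization. The classical function of the
martingale `x` and its `±1`-transform is written here in the coordinates `u + v = x` and
`u - v`, in which it is concave in each variable. -/
def burkholderFun (p u v : ℝ) : ℝ :=
  min 1 (p - 1) * max |u| |v| ^ p - p / 2 * max |u| |v| ^ (p - 1) * |u + v|

theorem burkholderFun_comm (p u v : ℝ) : burkholderFun p u v = burkholderFun p v u := by
  simp only [burkholderFun, max_comm |u| |v|, add_comm u v]

theorem burkholderFun_neg (p u v : ℝ) : burkholderFun p (-u) (-v) = burkholderFun p u v := by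
  simp only [burkholderFun, abs_neg, ← neg_add]

/-- The affine part and the two branches: at most one of `max u v` and `max (-u) v` differs from
`v`, so at most one of the brackets is nonzero. -/
theorem burkholderFun_eq_branches {p : ℝ} (hp : 1 < p) {v : ℝ} (hv : 0 ≤ v) (u : ℝ) :
    burkholderFun p u v = min 1 (p - 1) * v ^ p - p / 2 * v ^ (p - 1) * (u + v)
      + (((min 1 (p - 1) - p / 2) * max u v ^ p
        - 1 * (p / 2) * v * max u v ^ (p - 1) + 1 * (p / 2) * v ^ (p - 1) * max u v)
        - (min 1 (p - 1) - p / 2) * v ^ p)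
      + (((min 1 (p - 1) - p / 2) * max (-u) v ^ p
        - (-1) * (p / 2) * v * max (-u) v ^ (p - 1) + (-1) * (p / 2) * v ^ (p - 1) * max (-u) v)
        - (min 1 (p - 1) - p / 2) * v ^ p) := by
  have hpow : ∀ w : ℝ, 0 ≤ w → w ^ p = w * w ^ (p - 1) := fun w hw => by
    rw [← Real.rpow_one_add' hw (by linarith)]; ring_nf
  unfold burkholderFun
  rw [abs_of_nonneg hv]
  rcases le_total v u with h | h
  · have hu : 0 ≤ u := hv.trans h
    rw [abs_of_nonneg hu, max_eq_left h, max_eq_right (by linarith : -u ≤ v),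
      abs_of_nonneg (by linarith : 0 ≤ u + v), hpow u hu, hpow v hv]
    ring
  · rcases le_total (-u) v with h' | h'
    · rw [max_eq_right (abs_le.2 ⟨by linarith, h⟩), max_eq_right h, max_eq_right h',
        abs_of_nonneg (by linarith : 0 ≤ u + v), hpow v hv]
      ring
    · have hu : u ≤ 0 := by linarith
      rw [abs_of_nonpos hu, max_eq_left h', max_eq_right h,
        abs_of_nonpos (by linarith : u + v ≤ 0), hpow (-u) (by linarith), hpow v hv]
      ring

/-- Each branch is a concave antitone function of a convex function of `u`, hence concave. -/
theorem concaveOn_burkholderFun_left {p : ℝ} (hp : 1 < p) (v : ℝ) :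
    ConcaveOn ℝ Set.univ fun u => burkholderFun p u v := by
  wlog hv : 0 ≤ v generalizing v
  · have h := this (-v) (by linarith)
    refine ⟨convex_univ, fun a _ b _ s t hs ht hst => ?_⟩
    have h' := h.2 (Set.mem_univ (-a)) (Set.mem_univ (-b)) hs ht hst
    simp only [burkholderFun_neg] at h'
    rwa [show s • -a + t • -b = -(s • a + t • b) by simp; ring,
      burkholderFun_neg] at h'
  have hcomp : ∀ {g : ℝ → ℝ} {m : ℝ → ℝ}, ConcaveOn ℝ (Set.Ici v) g → AntitoneOn g (Set.Ici v) →
      ConvexOn ℝ Set.univ m → (∀ u, v ≤ m u) → ConcaveOn ℝ Set.univ fun u => g (m u) := by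
    intro g m hg hga hm hmv
    refine ⟨convex_univ, fun a _ b _ s t hs ht hst => ?_⟩
    refine (hg.2 (Set.mem_Ici.2 (hmv a)) (Set.mem_Ici.2 (hmv b)) hs ht hst).trans ?_
    exact hga (Set.mem_Ici.2 (hmv _))
      (hg.1 (Set.mem_Ici.2 (hmv a)) (Set.mem_Ici.2 (hmv b)) hs ht hst)
      (hm.2 (Set.mem_univ a) (Set.mem_univ b) hs ht hst)
  have h1 := burkholder_branch hp hv (Or.inl (rfl : (1 : ℝ) = 1))
  have h2 := burkholder_branch hp hv (Or.inr (rfl : (-1 : ℝ) = -1))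
  have hid : ConvexOn ℝ Set.univ fun u : ℝ => u := convexOn_id convex_univ
  have hneg : ConvexOn ℝ Set.univ fun u : ℝ => -u := (concaveOn_id convex_univ).neg
  have hconst : ConvexOn ℝ Set.univ fun _ : ℝ => v := convexOn_const _ convex_univ
  have c1 := hcomp h1.1 h1.2 (hid.sup hconst) (fun u => le_max_right u v)
  have c2 := hcomp h2.1 h2.2 (hneg.sup hconst) (fun u => le_max_right (-u) v)
  have c0 : ConcaveOn ℝ Set.univ fun u : ℝ =>
      min 1 (p - 1) * v ^ p - p / 2 * v ^ (p - 1) * (u + v) := by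
    refine ⟨convex_univ, fun a _ b _ s t hs ht hst => le_of_eq ?_⟩
    obtain rfl : t = 1 - s := by linarith
    simp only [smul_eq_mul]; ring
  have c3 := (c0.add (c1.add_const (-((min 1 (p - 1) - p / 2) * v ^ p)))).add
    (c2.add_const (-((min 1 (p - 1) - p / 2) * v ^ p)))
  refine c3.congr fun u _ => ?_
  rw [burkholderFun_eq_branches hp hv]
  rfl

/-- The two-point Jensen inequality along a step of a martingale transform with multiplier
`θ ∈ {0, 1}`: only one of the two arguments of `burkholderFun` moves. -/
theorem burkholderFun_step {p : ℝ} (hp : 1 < p) {a b : ℝ} (ha : 0 ≤ a) (hb : 0 ≤ b)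
    {θ : ℝ} (hθ : θ = 0 ∨ θ = 1) {x x₁ x₂ : ℝ} (hx : a * x₁ + b * x₂ = (a + b) * x) (y : ℝ) :
    a * burkholderFun p (y + θ * (x₁ - x)) (x₁ - (y + θ * (x₁ - x)))
      + b * burkholderFun p (y + θ * (x₂ - x)) (x₂ - (y + θ * (x₂ - x)))
      ≤ (a + b) * burkholderFun p y (x - y) := by
  rcases (add_nonneg ha hb).eq_or_lt with h0 | h0
  · obtain rfl : a = 0 := by linarith
    obtain rfl : b = 0 := by linarith
    simp
  have jensen : ∀ {g : ℝ → ℝ}, ConcaveOn ℝ Set.univ g → ∀ {z z₁ z₂ : ℝ},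
      a * z₁ + b * z₂ = (a + b) * z → a * g z₁ + b * g z₂ ≤ (a + b) * g z := by
    intro g hg z z₁ z₂ hz
    have h := hg.2 (Set.mem_univ z₁) (Set.mem_univ z₂) (div_nonneg ha h0.le)
      (div_nonneg hb h0.le) (by field_simp)
    rw [show (a / (a + b)) • z₁ + (b / (a + b)) • z₂ = z by
      simp only [smul_eq_mul]; field_simp; linarith] at h
    calc a * g z₁ + b * g z₂
        = (a + b) * ((a / (a + b)) • g z₁ + (b / (a + b)) • g z₂) := by
          simp only [smul_eq_mul]; field_simp
      _ ≤ _ := mul_le_mul_of_nonneg_left h h0.le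
  rcases hθ with rfl | rfl
  · have h := jensen (concaveOn_burkholderFun_left hp y) (z := x - y) (z₁ := x₁ - y)
      (z₂ := x₂ - y) (by linear_combination hx)
    simpa [burkholderFun_comm p y] using h
  · have h := jensen (concaveOn_burkholderFun_left hp (x - y)) (z := y) (z₁ := y + (x₁ - x))
      (z₂ := y + (x₂ - x)) (by linear_combination hx)
    simpa [show ∀ t, t - (y + (t - x)) = x - y by intro t; ring] using h

theorem burkholderFun_zero_left_nonpos {p : ℝ} (hp : 1 < p) (x : ℝ) :
    burkholderFun p 0 x ≤ 0 := by
  have e : |x| ^ p = |x| * |x| ^ (p - 1) := by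
    rw [← Real.rpow_one_add' (abs_nonneg x) (by linarith)]; ring_nf
  have h : burkholderFun p 0 x = (min 1 (p - 1) - p / 2) * (|x| * |x| ^ (p - 1)) := by
    simp only [burkholderFun, abs_zero, max_eq_right (abs_nonneg x), zero_add, e]; ring
  rw [h]
  refine mul_nonpos_of_nonpos_of_nonneg ?_ (by positivity)
  have h1 := min_le_left 1 (p - 1)
  have h2 := min_le_right 1 (p - 1)
  linarith

/-- `burkholderFun` dominates a multiple of `|u| ^ p` up to a multiple of `|u + v| ^ p`. -/
theorem exists_abs_rpow_le_burkholderFun {p : ℝ} (hp : 1 < p) :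
    ∃ A B : ℝ, 0 ≤ A ∧ 0 ≤ B ∧ ∀ u v : ℝ,
      |u| ^ p ≤ A * burkholderFun p u v + B * |u + v| ^ p := by
  have hc : 0 < min 1 (p - 1) := lt_min one_pos (by linarith)
  set c := min 1 (p - 1) with hcdef
  have hp0 : 0 < p := by linarith
  -- Either `m = max |u| |v|` is at least `(p / c) |u + v|` and half of `c m ^ p` survives,
  -- or `m ^ (p - 1)` is comparable to `|u + v| ^ (p - 1)`.
  set K : ℝ := p / c with hK
  have hK0 : 0 < K := by positivity
  have main : ∀ u v : ℝ, c / 2 * |u| ^ p ≤ burkholderFun p u v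
      + (p / 2 * K ^ (p - 1) + c / 2 * K ^ p) * |u + v| ^ p := by
    intro u v
    set m := max |u| |v| with hm
    have hm0 : 0 ≤ m := (abs_nonneg u).trans (le_max_left _ _)
    have hum : |u| ^ p ≤ m ^ p := Real.rpow_le_rpow (abs_nonneg u) (le_max_left _ _) hp0.le
    have e : ∀ t : ℝ, 0 ≤ t → t ^ p = t ^ (p - 1) * t := fun t ht => by
      rw [← Real.rpow_add_one' ht (by linarith)]; ring_nf
    have hW : burkholderFun p u v = c * m ^ p - p / 2 * m ^ (p - 1) * |u + v| := rfl
    have hmp : 0 ≤ m ^ (p - 1) := Real.rpow_nonneg hm0 _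
    have hx := abs_nonneg (u + v)
    rw [hW]
    rcases le_total (K * |u + v|) m with h | h
    · have h1 : p * |u + v| ≤ c * m := by
        rw [hK, div_mul_eq_mul_div, div_le_iff₀ hc] at h; linarith
      have h2 : p / 2 * m ^ (p - 1) * |u + v| ≤ c / 2 * m ^ p := by
        rw [e m hm0]; nlinarith
      have h3 : 0 ≤ (p / 2 * K ^ (p - 1) + c / 2 * K ^ p) * |u + v| ^ p := by positivity
      nlinarith
    · have h1 : m ^ (p - 1) ≤ K ^ (p - 1) * |u + v| ^ (p - 1) := by
        rw [← Real.mul_rpow hK0.le hx]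
        exact Real.rpow_le_rpow hm0 h (by linarith)
      have h2 : p / 2 * m ^ (p - 1) * |u + v| ≤ p / 2 * K ^ (p - 1) * |u + v| ^ p := by
        rw [e _ hx]
        have := mul_le_mul_of_nonneg_right h1 hx
        nlinarith
      have h3 : 0 ≤ c / 2 * K ^ p * |u + v| ^ p := by positivity
      have h4 : 0 ≤ m ^ p := Real.rpow_nonneg hm0 _
      nlinarith
  set B := p / 2 * K ^ (p - 1) + c / 2 * K ^ p with hB
  have hB0 : 0 ≤ B := by positivity
  refine ⟨2 / c, 2 / c * B, by positivity, by positivity, fun u v => ?_⟩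
  have h := mul_le_mul_of_nonneg_left (main u v) (by positivity : 0 ≤ 2 / c)
  calc |u| ^ p = 2 / c * (c / 2 * |u| ^ p) := by field_simp
    _ ≤ _ := h
    _ = _ := by ring

/-- Jensen's inequality for one generation. The pieces `0, …, M - 1` have masses `w j` and
integrals `F j`, and `T u`, `G u` are the mass and the integral of the tail `{u, …, M - 1}`. The
pieces are split off one at a time; the `u`-th splitting has the multiplier `θ u ∈ {0, 1}`. -/
theorem burkholderFun_tail_le {p : ℝ} (hp : 1 < p) {M : ℕ} {w F T G θ : ℕ → ℝ}
    (hw : ∀ j, 0 ≤ w j) (hF : ∀ j, w j = 0 → F j = 0)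
    (hT : ∀ u, T u = ∑ j ∈ Finset.Ico u M, w j) (hG : ∀ u, G u = ∑ j ∈ Finset.Ico u M, F j)
    (hθ : ∀ u, θ u = 0 ∨ θ u = 1) {d : ℕ → ℕ → ℝ} (hd_lt : ∀ v j, j < v → d v j = 0)
    (hd_eq : ∀ v, d v v = F v / w v - G v / T v)
    (hd_gt : ∀ v j, v < j → d v j = G (v + 1) / T (v + 1) - G v / T v) :
    ∀ (r u : ℕ), u + r = M → ∀ y : ℝ,
      ∑ j ∈ Finset.Ico u M, w j * burkholderFun p (y + ∑ v ∈ Finset.Ico u M, θ v * d v j)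
          (F j / w j - (y + ∑ v ∈ Finset.Ico u M, θ v * d v j))
        ≤ T u * burkholderFun p y (G u / T u - y) := by
  intro r
  induction r with
  | zero =>
    rintro u rfl y
    simp [hT]
  | succ r ih =>
    intro u hu y
    have huM : u < M := by omega
    have ih' := ih (u + 1) (by omega)
      (y + θ u * (G (u + 1) / T (u + 1) - G u / T u))
    have hTu : T u = w u + T (u + 1) := by rw [hT, hT, Finset.sum_eq_sum_Ico_succ_bot huM]
    have hGu : G u = F u + G (u + 1) := by rw [hG, hG, Finset.sum_eq_sum_Ico_succ_bot huM]
    have hT0 : ∀ v, 0 ≤ T v := fun v => hT v ▸ Finset.sum_nonneg fun j _ => hw j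
    have hGT : ∀ v, T v = 0 → G v = 0 := by
      intro v hv
      rw [hT, Finset.sum_eq_zero_iff_of_nonneg fun j _ => hw j] at hv
      rw [hG]
      exact Finset.sum_eq_zero fun j hj => hF j (hv j hj)
    have step := burkholderFun_step hp (hw u) (hT0 (u + 1)) (hθ u) (x := G u / T u)
      (x₁ := F u / w u) (x₂ := G (u + 1) / T (u + 1))
      (by rw [← hTu, mul_div_cancel_of_imp' (hF u), mul_div_cancel_of_imp' (hGT _),
            mul_div_cancel_of_imp' (hGT _), hGu]) y
    rw [← hTu] at step
    refine le_trans ?_ step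
    rw [Finset.sum_eq_sum_Ico_succ_bot huM]
    refine add_le_add (le_of_eq ?_) (le_trans (le_of_eq ?_) ih')
    · have : ∑ v ∈ Finset.Ico u M, θ v * d v u = θ u * (F u / w u - G u / T u) := by
        rw [Finset.sum_eq_sum_Ico_succ_bot huM, hd_eq, Finset.sum_eq_zero, add_zero]
        intro v hv
        rw [hd_lt v u (by have := (Finset.mem_Ico.1 hv).1; omega), mul_zero]
      rw [this]
    · refine Finset.sum_congr rfl fun j hj => ?_
      have : ∑ v ∈ Finset.Ico u M, θ v * d v j = θ u * (G (u + 1) / T (u + 1) - G u / T u)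
          + ∑ v ∈ Finset.Ico (u + 1) M, θ v * d v j := by
        rw [Finset.sum_eq_sum_Ico_succ_bot huM,
          hd_gt u j (by have := (Finset.mem_Ico.1 hj).1; omega)]
      rw [this, ← add_assoc]

/-! ### Dyadic cubes -/

namespace DyadicSystem

variable {X : Type*} [QuasiMetricSpace X] [MeasurableSpace X] (D : DyadicSystem X)

theorem exists_mem_cube (k : ℤ) (x : X) : ∃ α, x ∈ D.cube k α := by
  have h : x ∈ ⋃ α, D.cube k α := D.cover k ▸ Set.mem_univ x
  simpa using h

/-- The index of the cube of generation `k` that contains `x`. -/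
def idx (k : ℤ) (x : X) : D.A k := (D.exists_mem_cube k x).choose

theorem mem_cube_idx (k : ℤ) (x : X) : x ∈ D.cube k (D.idx k x) :=
  (D.exists_mem_cube k x).choose_spec

variable {D} in
theorem eq_of_mem_of_mem {k : ℤ} {α β : D.A k} {x : X} (hα : x ∈ D.cube k α)
    (hβ : x ∈ D.cube k β) : α = β := by
  by_contra h
  exact Set.disjoint_left.1 (D.disjoint k α β h) hα hβ

variable {D} in
theorem idx_eq {k : ℤ} {α : D.A k} {x : X} (h : x ∈ D.cube k α) : D.idx k x = α :=
  eq_of_mem_of_mem (D.mem_cube_idx k x) h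

theorem preimage_idx (k : ℤ) (α : D.A k) : D.idx k ⁻¹' {α} = D.cube k α := by
  ext x
  exact ⟨fun h => by rw [← Set.mem_singleton_iff.1 h]; exact D.mem_cube_idx k x, fun h => idx_eq h⟩

theorem pairwise_disjoint_cube (k : ℤ) : Pairwise (Function.onFun Disjoint (D.cube k)) :=
  fun α β h => D.disjoint k α β h

theorem center_mem_cube (k : ℤ) (α : D.A k) : D.center k α ∈ D.cube k α := by
  refine D.qball_subset_cube k α ?_
  change QuasiMetricSpace.qdist _ _ < _
  rw [(QuasiMetricSpace.qdist_eq_zero_iff _ _).2 rfl]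
  exact mul_pos D.c₁_pos (zpow_pos D.δ_pos k)

variable {D} in
theorem cube_subset_of_mem {k l : ℤ} (h : k ≤ l) {α : D.A k} {β : D.A l} {x : X}
    (hα : x ∈ D.cube k α) (hβ : x ∈ D.cube l β) : D.cube l β ⊆ D.cube k α :=
  (D.nested k l α β h).resolve_right fun hd => Set.disjoint_left.1 hd hα hβ

theorem cube_idx_anti {k l : ℤ} (h : k ≤ l) (x : X) :
    D.cube l (D.idx l x) ⊆ D.cube k (D.idx k x) :=
  cube_subset_of_mem h (D.mem_cube_idx k x) (D.mem_cube_idx l x)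

theorem finite_child (k : ℤ) (α : D.A k) :
    {β : D.A (k + 1) | D.cube (k + 1) β ⊆ D.cube k α}.Finite :=
  Set.finite_of_encard_le_coe (D.children_card k α).2

instance (k : ℤ) (α : D.A k) : Finite (D.Child k α) := D.finite_child k α

instance (k : ℤ) (α : D.A k) : Nonempty (D.Child k α) := by
  have h := (D.children_card k α).1
  rw [Set.one_le_encard_iff_nonempty] at h
  exact h.to_subtype

theorem numChildren_pos (k : ℤ) (α : D.A k) : 0 < D.numChildren k α := Nat.card_pos

/-- A cube contains only finitely many cubes of a given later generation. -/
theorem finite_cube_subset {k l : ℤ} (h : k ≤ l) (α : D.A k) :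
    {β : D.A l | D.cube l β ⊆ D.cube k α}.Finite := by
  induction l, h using Int.leInduction with
  | base =>
    refine (Set.finite_singleton α).subset fun β hβ => ?_
    exact eq_of_mem_of_mem (D.center_mem_cube k β) (hβ (D.center_mem_cube k β))
  | succ l h ih =>
    refine (ih.biUnion fun γ _ => D.finite_child l γ).subset fun β hβ => ?_
    have hc := D.center_mem_cube (l + 1) β
    refine Set.mem_biUnion (x := D.idx l (D.center (l + 1) β)) ?_ ?_
    · exact cube_subset_of_mem h (hβ hc) (D.mem_cube_idx l _)
    · exact cube_subset_of_mem (by omega) (D.mem_cube_idx l _) hc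

/-- The cubes around the distinguished center exhaust the space. -/
theorem exists_forall_mem_cube_idx {x₀ : X} (hx₀ : ∀ k : ℤ, ∃ α : D.A k, D.center k α = x₀)
    (x : X) : ∃ m : ℤ, ∀ k ≤ m, x ∈ D.cube k (D.idx k x₀) := by
  set r := QuasiMetricSpace.qdist x₀ x with hr
  have hr0 : 0 ≤ r := QuasiMetricSpace.qdist_nonneg _ _
  obtain ⟨n, hn⟩ := exists_pow_lt_of_lt_one (div_pos D.c₁_pos (by linarith : 0 < r + 1))
    D.δ_lt_one
  have hδn : 0 < D.δ ^ n := pow_pos D.δ_pos n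
  refine ⟨-n, fun k hk => D.cube_idx_anti hk x₀ ?_⟩
  obtain ⟨α, hα⟩ := hx₀ (-n)
  have hxα : x ∈ D.cube (-n) α := by
    refine D.qball_subset_cube _ α ?_
    change QuasiMetricSpace.qdist _ _ < _
    rw [hα, ← hr, zpow_neg, zpow_natCast, ← div_eq_mul_inv, lt_div_iff₀ hδn]
    rw [lt_div_iff₀ (by linarith)] at hn
    nlinarith
  rw [idx_eq (hα ▸ D.center_mem_cube (-n) α)]
  exact hxα

/-- Around each point of an open set, the cubes of high generation lie in the set. -/
theorem exists_cube_idx_subset {Ω : Set X} (hΩ : IsOpen Ω) {x : X} (hx : x ∈ Ω) :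
    ∃ n : ℕ, D.cube n (D.idx n x) ⊆ Ω := by
  obtain ⟨ε, hε, hsub⟩ := (QuasiMetricSpace.isOpen_iff_qball Ω).1 hΩ x hx
  obtain ⟨A₀, hA₀, htri⟩ := QuasiMetricSpace.exists_quasi_triangle (X := X)
  have hC : 0 < D.C₁ := D.c₁_pos.trans_le D.c₁_le_C₁
  obtain ⟨n, hn⟩ := exists_pow_lt_of_lt_one (by positivity : 0 < ε / (2 * A₀ * D.C₁)) D.δ_lt_one
  refine ⟨n, fun y hy => hsub ?_⟩
  have h1 := D.cube_subset_qball n _ (D.mem_cube_idx n x)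
  have h2 := D.cube_subset_qball n _ hy
  change QuasiMetricSpace.qdist _ _ < _ at h1 h2
  rw [zpow_natCast] at h1 h2
  rw [lt_div_iff₀ (by positivity)] at hn
  have h3 := htri x y (D.center n (D.idx n x))
  rw [QuasiMetricSpace.qdist_comm x (D.center _ _)] at h3
  have h4 := mul_le_mul_of_nonneg_left (add_lt_add h1 h2).le (by linarith : 0 ≤ A₀)
  change QuasiMetricSpace.qdist x y < ε
  nlinarith

/-- The `σ`-algebra generated by the cubes of generation `k`. -/
abbrev sigmaAlgebra (k : ℤ) : MeasurableSpace X := MeasurableSpace.comap (D.idx k) ⊤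

theorem measurableSet_preimage_idx (k : ℤ) (s : Set (D.A k)) : MeasurableSet (D.idx k ⁻¹' s) := by
  have := D.countable_A k
  rw [← Set.biUnion_preimage_singleton]
  refine MeasurableSet.biUnion (Set.to_countable s) fun α _ => ?_
  rw [preimage_idx]
  exact D.measurableSet_cube k α

theorem sigmaAlgebra_le (k : ℤ) : D.sigmaAlgebra k ≤ ‹MeasurableSpace X› := by
  rintro _ ⟨s, -, rfl⟩
  exact D.measurableSet_preimage_idx k s

theorem sigmaAlgebra_mono {k l : ℤ} (h : k ≤ l) : D.sigmaAlgebra k ≤ D.sigmaAlgebra l := by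
  rintro _ ⟨s, -, rfl⟩
  refine ⟨D.idx l '' (D.idx k ⁻¹' s), trivial, ?_⟩
  ext x
  refine ⟨?_, fun hx => ⟨x, hx, rfl⟩⟩
  rintro ⟨y, hy, hxy⟩
  have hx : x ∈ D.cube k (D.idx k y) :=
    D.cube_idx_anti h y (hxy ▸ D.mem_cube_idx l x)
  rwa [Set.mem_preimage, idx_eq hx]

/-- The filtration of the cubes of generation `0, 1, 2, …`. -/
def filtration : Filtration ℕ ‹MeasurableSpace X› where
  seq n := D.sigmaAlgebra n
  mono' _ _ h := D.sigmaAlgebra_mono (by exact_mod_cast h)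
  le' n := D.sigmaAlgebra_le n

/-- Every open set is a union of cubes, so the cubes generate the Borel `σ`-algebra. -/
theorem iSup_filtration [BorelSpace X] : ⨆ n, D.filtration n = ‹MeasurableSpace X› := by
  refine le_antisymm (iSup_le D.filtration.le) ?_
  refine (BorelSpace.measurable_eq (α := X)).le.trans
    (MeasurableSpace.generateFrom_le fun Ω hΩ => ?_)
  have e : Ω = ⋃ (n : ℕ), D.idx n ⁻¹' {α | D.cube n α ⊆ Ω} := by
    ext x
    simp only [Set.mem_iUnion, Set.mem_preimage, Set.mem_ofPred_eq]
    exact ⟨fun hx => D.exists_cube_idx_subset hΩ hx, fun ⟨n, hn⟩ => hn (D.mem_cube_idx n x)⟩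
  rw [e]
  refine MeasurableSet.iUnion fun n => ?_
  exact le_iSup (fun n => (D.filtration n : MeasurableSpace X)) n _ ⟨_, trivial, rfl⟩

end DyadicSystem

/-! ### Averages over cubes and their limit almost everywhere -/

section Lp

variable {X E : Type*} [MeasurableSpace X] {μ : Measure X} [NormedAddCommGroup E]
  {p : ℝ≥0∞}

/-- Dominated convergence in `L^p`. -/
theorem tendsto_eLpNorm_sub_of_dominated {ι : Type*} {l : Filter ι} [l.IsCountablyGenerated]
    (hp0 : p ≠ 0) (hp : p ≠ ∞) {F : ι → X → E} {f : X → E} {G : X → ℝ}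
    (hF : ∀ i, AEStronglyMeasurable (F i) μ) (hf : AEStronglyMeasurable f μ)
    (hG : MemLp G p μ) (hbound : ∀ᶠ i in l, ∀ᵐ x ∂μ, ‖F i x - f x‖ ≤ G x)
    (hlim : ∀ᵐ x ∂μ, Tendsto (fun i => F i x) l (𝓝 (f x))) :
    Tendsto (fun i => eLpNorm (fun x => F i x - f x) p μ) l (𝓝 0) := by
  have hp' : 0 < p.toReal := ENNReal.toReal_pos hp0 hp
  have h := tendsto_lintegral_filter_of_dominated_convergence' (μ := μ) (l := l)
    (F := fun i x => ‖F i x - f x‖ₑ ^ p.toReal) (f := fun _ => 0)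
    (fun x => ‖G x‖ₑ ^ p.toReal)
    (Eventually.of_forall fun i => ((hF i).sub hf).enorm.pow_const _)
    (hbound.mono fun i hi => hi.mono fun x hx => by
      gcongr
      rw [enorm_le_iff_norm_le, Real.norm_eq_abs]
      exact hx.trans (le_abs_self _))
    (by
      have := lintegral_rpow_enorm_lt_top_of_eLpNorm_lt_top hp0 hp hG.2
      exact this.ne)
    (hlim.mono fun x hx => by
      have h1 : Tendsto (fun i => ‖F i x - f x‖ₑ) l (𝓝 0) := by
        have := (hx.sub_const (f x)).enorm
        simpa using this
      have h2 := (ENNReal.continuous_rpow_const (y := p.toReal)).tendsto 0 |>.comp h1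
      rwa [ENNReal.zero_rpow_of_pos hp'] at h2)
  rw [lintegral_zero] at h
  have h2 := (ENNReal.continuous_rpow_const (y := 1 / p.toReal)).tendsto 0 |>.comp h
  rw [ENNReal.zero_rpow_of_pos (by positivity)] at h2
  refine h2.congr fun i => ?_
  rw [eLpNorm_eq_lintegral_rpow_enorm_toReal hp0 hp]
  rfl

theorem MeasureTheory.MemLp.integrableOn_of_measure_ne_top {f : X → E} (hf : MemLp f p μ)
    (hp : 1 ≤ p) {s : Set X} (hs : μ s ≠ ∞) : IntegrableOn f s μ := by
  have : IsFiniteMeasure (μ.restrict s) := isFiniteMeasure_restrict.2 hs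
  exact (hf.restrict s).integrable hp

/-- Jensen's inequality for the average over a set. -/
theorem enorm_setAverage_rpow_mul_le [NormedSpace ℝ E] (hp1 : 1 ≤ p) (hp : p ≠ ∞) {f : X → E}
    {s : Set X} (hs : μ s ≠ ∞) (hf : AEStronglyMeasurable f (μ.restrict s)) :
    ‖⨍ x in s, f x ∂μ‖ₑ ^ p.toReal * μ s ≤ ∫⁻ x in s, ‖f x‖ₑ ^ p.toReal ∂μ := by
  have hp0 : p ≠ 0 := (zero_lt_one.trans_le hp1).ne'
  have hp' : 0 < p.toReal := ENNReal.toReal_pos hp0 hp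
  rcases eq_or_ne (μ s) 0 with h0 | h0
  · simp [h0]
  have h1 : ‖∫ x in s, f x ∂μ‖ₑ ≤ eLpNorm f p (μ.restrict s) * μ s ^ (1 - 1 / p.toReal) := by
    refine (enorm_integral_le_lintegral_enorm _).trans ?_
    rw [← eLpNorm_one_eq_lintegral_enorm]
    refine (eLpNorm_le_eLpNorm_mul_rpow_measure_univ hp1 hf).trans ?_
    simp
  have h2 : ‖⨍ x in s, f x ∂μ‖ₑ * μ s = ‖∫ x in s, f x ∂μ‖ₑ := by
    rw [setAverage_eq, enorm_smul, mul_right_comm]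
    rw [Real.enorm_eq_ofReal (by positivity), measureReal_def, ENNReal.ofReal_inv_of_pos
      (ENNReal.toReal_pos h0 hs), ENNReal.ofReal_toReal hs,
      ENNReal.inv_mul_cancel h0 hs, one_mul]
  have h3 := ENNReal.rpow_le_rpow (h2.le.trans h1) hp'.le
  rw [ENNReal.mul_rpow_of_nonneg _ _ hp'.le, ENNReal.mul_rpow_of_nonneg _ _ hp'.le,
    ← ENNReal.rpow_mul, eLpNorm_eq_lintegral_rpow_enorm_toReal hp0 hp, ← ENNReal.rpow_mul,
    one_div_mul_cancel hp'.ne', ENNReal.rpow_one,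
    show (1 - 1 / p.toReal) * p.toReal = p.toReal - 1 by field_simp] at h3
  have h4 : μ s ^ (p.toReal - 1) ≠ 0 := by
    simp [ENNReal.rpow_eq_zero_iff, h0, hs]
  have h5 : μ s ^ (p.toReal - 1) ≠ ∞ := by
    simp [ENNReal.rpow_eq_top_iff, h0, hs]
  rw [show μ s ^ p.toReal = μ s * μ s ^ (p.toReal - 1) by
    nth_rewrite 2 [← ENNReal.rpow_one (μ s)]
    rw [← ENNReal.rpow_add _ _ h0 hs]; ring_nf, ← mul_assoc] at h3
  exact (ENNReal.mul_le_mul_iff_left h4 h5).1 h3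

end Lp

theorem pairing_indicator_const {X 𝕜 : Type*} [MeasurableSpace X] [RCLike 𝕜] {μ : Measure X}
    (f : X → 𝕜) {s : Set X} (hs : MeasurableSet s) (c : ℝ) :
    pairing μ f (s.indicator fun _ => c) = (∫ x in s, f x ∂μ) * (c : 𝕜) := by
  rw [pairing, ← integral_mul_const, ← integral_indicator hs]
  congr 1
  ext x
  by_cases hx : x ∈ s <;> simp [hx]

namespace DyadicSystem

variable {X 𝕜 : Type*} [QuasiMetricSpace X] [MeasurableSpace X] [RCLike 𝕜]
  {D : DyadicSystem X} {μ : Measure X} {p : ℝ≥0∞} {f g : X → 𝕜}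

/-- `averageSum` is the conditional expectation onto the cubes of generation `m`. -/
theorem averageSum_of_mem (f : X → 𝕜) {m : ℤ} {α : D.A m} {x : X} (hx : x ∈ D.cube m α) :
    D.averageSum μ f m x = ⨍ y in D.cube m α, f y ∂μ := by
  rw [averageSum, tsum_eq_single α]
  · rw [haarZero, pairing_indicator_const f (D.measurableSet_cube m α), setAverage_eq,
      Set.indicator_of_mem hx, mul_assoc, ← RCLike.ofReal_mul, ← mul_inv,
      Real.mul_self_sqrt measureReal_nonneg, RCLike.real_smul_eq_coe_mul, mul_comm]
  · intro β hβ
    have : x ∉ D.cube m β := fun h => hβ (eq_of_mem_of_mem h hx)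
    simp [haarZero, this]

theorem averageSum_eq (f : X → 𝕜) (m : ℤ) (x : X) :
    D.averageSum μ f m x = ⨍ y in D.cube m (D.idx m x), f y ∂μ :=
  averageSum_of_mem f (D.mem_cube_idx m x)

theorem stronglyMeasurable_averageSum (f : X → 𝕜) (m : ℤ) :
    StronglyMeasurable[D.sigmaAlgebra m] (D.averageSum μ f m) := by
  have e : D.averageSum μ f m =
      (fun α => ⨍ y in D.cube m α, f y ∂μ) ∘ D.idx m := by
    ext x; exact averageSum_eq f m x
  rw [e]
  exact (measurable_from_top.comp (comap_measurable (D.idx m))).stronglyMeasurable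

theorem aestronglyMeasurable_averageSum (f : X → 𝕜) (m : ℤ) :
    AEStronglyMeasurable (D.averageSum μ f m) μ :=
  ((stronglyMeasurable_averageSum f m).mono (D.sigmaAlgebra_le m)).aestronglyMeasurable

theorem lintegral_eq_tsum_cube (D : DyadicSystem X) (μ : Measure X) (m : ℤ) (F : X → ℝ≥0∞) :
    ∫⁻ x, F x ∂μ = ∑' α, ∫⁻ x in D.cube m α, F x ∂μ := by
  have := D.countable_A m
  rw [← lintegral_iUnion (D.measurableSet_cube m) (D.pairwise_disjoint_cube m), D.cover,
    setLIntegral_univ]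

/-- Averaging over the cubes of one generation is a contraction of `L^p`. -/
theorem eLpNorm_averageSum_le (hμ : ∀ k α, μ (D.cube k α) ≠ ∞) (hp1 : 1 ≤ p) (hp : p ≠ ∞)
    (hf : AEStronglyMeasurable f μ) (m : ℤ) :
    eLpNorm (D.averageSum μ f m) p μ ≤ eLpNorm f p μ := by
  have hp0 : p ≠ 0 := (zero_lt_one.trans_le hp1).ne'
  rw [eLpNorm_eq_lintegral_rpow_enorm_toReal hp0 hp, eLpNorm_eq_lintegral_rpow_enorm_toReal hp0 hp]
  gcongr ?_ ^ _
  rw [lintegral_eq_tsum_cube D μ m, lintegral_eq_tsum_cube D μ m]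
  refine ENNReal.tsum_le_tsum fun α => ?_
  refine le_trans (le_of_eq ?_) (enorm_setAverage_rpow_mul_le hp1 hp (hμ m α) hf.restrict)
  rw [setLIntegral_congr_fun (D.measurableSet_cube m α)
    (g := fun _ => ‖⨍ y in D.cube m α, f y ∂μ‖ₑ ^ p.toReal)
    (fun x hx => by simp only [averageSum_of_mem f hx]), setLIntegral_const]

theorem memLp_averageSum (hμ : ∀ k α, μ (D.cube k α) ≠ ∞) (hp1 : 1 ≤ p) (hp : p ≠ ∞)
    (hf : MemLp f p μ) (m : ℤ) : MemLp (D.averageSum μ f m) p μ :=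
  ⟨aestronglyMeasurable_averageSum f m,
    (eLpNorm_averageSum_le hμ hp1 hp hf.1 m).trans_lt hf.2⟩

theorem averageSum_sub (hμ : ∀ k α, μ (D.cube k α) ≠ ∞) (hp1 : 1 ≤ p)
    (hf : MemLp f p μ) (hg : MemLp g p μ) (m : ℤ) (x : X) :
    D.averageSum μ (fun y => f y - g y) m x = D.averageSum μ f m x - D.averageSum μ g m x := by
  simp only [averageSum_eq, setAverage_eq]
  rw [integral_sub (hf.integrableOn_of_measure_ne_top hp1 (hμ _ _))
    (hg.integrableOn_of_measure_ne_top hp1 (hμ _ _)), smul_sub]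

theorem setIntegral_averageSum_cube (hμ : ∀ k α, μ (D.cube k α) ≠ ∞) (f : X → 𝕜) {m : ℤ}
    (α : D.A m) : ∫ x in D.cube m α, D.averageSum μ f m x ∂μ = ∫ x in D.cube m α, f x ∂μ := by
  rw [setIntegral_congr_fun (D.measurableSet_cube m α)
    (fun x hx => averageSum_of_mem (μ := μ) f hx), setIntegral_const]
  exact measure_smul_setAverage f (hμ m α)

theorem setIntegral_averageSum_preimage (hμ : ∀ k α, μ (D.cube k α) ≠ ∞) {m : ℤ}
    {s : Set (D.A m)} (hf : IntegrableOn f (D.idx m ⁻¹' s) μ)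
    (hAf : IntegrableOn (D.averageSum μ f m) (D.idx m ⁻¹' s) μ) :
    ∫ x in D.idx m ⁻¹' s, D.averageSum μ f m x ∂μ = ∫ x in D.idx m ⁻¹' s, f x ∂μ := by
  have := D.countable_A m
  have e : D.idx m ⁻¹' s = ⋃ α : s, D.cube m α := by
    rw [← Set.biUnion_preimage_singleton, Set.biUnion_eq_iUnion]
    simp_rw [preimage_idx]
  have hd : Pairwise (Function.onFun Disjoint fun α : s => D.cube m α) :=
    fun α β h => D.pairwise_disjoint_cube m (Subtype.coe_injective.ne h)
  rw [e] at hf hAf ⊢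
  rw [integral_iUnion (fun α : s => D.measurableSet_cube m α) hd hf,
    integral_iUnion (fun α : s => D.measurableSet_cube m α) hd hAf]
  simp_rw [setIntegral_averageSum_cube hμ]

/-- Lévy's upward theorem on one cube of generation `0`. -/
theorem ae_restrict_tendsto_averageSum_real [BorelSpace X] (hμ : ∀ k α, μ (D.cube k α) ≠ ∞)
    (hp1 : 1 ≤ p) (hp : p ≠ ∞) {f : X → ℝ} (hf : MemLp f p μ) (α : D.A 0) :
    ∀ᵐ x ∂(μ.restrict (D.cube 0 α)),
      Tendsto (fun n : ℕ => D.averageSum μ f n x) atTop (𝓝 (f x)) := by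
  have : IsFiniteMeasure (μ.restrict (D.cube 0 α)) := isFiniteMeasure_restrict.2 (hμ 0 α)
  have hfi : Integrable f (μ.restrict (D.cube 0 α)) :=
    hf.integrableOn_of_measure_ne_top hp1 (hμ 0 α)
  have hlim := tendsto_ae_condExp (μ := μ.restrict (D.cube 0 α)) (ℱ := D.filtration) f
  have hlimit : (μ.restrict (D.cube 0 α))[f | ⨆ n, D.filtration n]
      =ᵐ[μ.restrict (D.cube 0 α)] f := by
    refine condExp_of_aestronglyMeasurable' (iSup_le D.filtration.le) ?_ hfi
    have := hfi.1
    rwa [iSup_filtration]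
  have hcond : ∀ n : ℕ, D.averageSum μ f n =ᵐ[μ.restrict (D.cube 0 α)]
      (μ.restrict (D.cube 0 α))[f | D.filtration n] := by
    intro n
    have hAi : Integrable (D.averageSum μ f n) (μ.restrict (D.cube 0 α)) :=
      (memLp_averageSum hμ hp1 hp hf n).integrableOn_of_measure_ne_top hp1 (hμ 0 α)
    refine ae_eq_condExp_of_forall_setIntegral_eq (D.filtration.le n) hfi
      (fun s _ _ => hAi.integrableOn) ?_ (stronglyMeasurable_averageSum f n).aestronglyMeasurable
    rintro s hs -
    obtain ⟨t, -, ht⟩ : MeasurableSet[D.sigmaAlgebra n] (s ∩ D.cube 0 α) :=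
      MeasurableSet.inter hs (D.sigmaAlgebra_mono (Int.natCast_nonneg n) _
        ⟨{α}, trivial, D.preimage_idx 0 α⟩)
    rw [Measure.restrict_restrict (D.filtration.le n s hs), ← ht]
    have hsub : D.idx n ⁻¹' t ⊆ D.cube 0 α := by rw [ht]; exact Set.inter_subset_right
    exact setIntegral_averageSum_preimage hμ (IntegrableOn.mono_set hfi hsub)
      (IntegrableOn.mono_set hAi hsub)
  filter_upwards [hlim, hlimit, ae_all_iff.2 hcond] with x h1 h2 h3
  rw [h2] at h1
  exact h1.congr fun n => (h3 n).symm

theorem ae_of_forall_ae_restrict_cube {P : X → Prop} (m : ℤ)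
    (h : ∀ α, ∀ᵐ x ∂(μ.restrict (D.cube m α)), P x) : ∀ᵐ x ∂μ, P x := by
  have := D.countable_A m
  rw [← Measure.restrict_univ (μ := μ), ← D.cover m, ae_restrict_iUnion_iff]
  exact h

theorem averageSum_re (hμ : ∀ k α, μ (D.cube k α) ≠ ∞) (hp1 : 1 ≤ p) (hf : MemLp f p μ)
    (m : ℤ) (x : X) : D.averageSum μ (fun y => RCLike.re (f y)) m x
      = RCLike.re (D.averageSum μ f m x) := by
  simp only [averageSum_eq, setAverage_eq]
  rw [integral_re (hf.integrableOn_of_measure_ne_top hp1 (hμ _ _)), RCLike.smul_re, smul_eq_mul]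

theorem averageSum_im (hμ : ∀ k α, μ (D.cube k α) ≠ ∞) (hp1 : 1 ≤ p) (hf : MemLp f p μ)
    (m : ℤ) (x : X) : D.averageSum μ (fun y => RCLike.im (f y)) m x
      = RCLike.im (D.averageSum μ f m x) := by
  simp only [averageSum_eq, setAverage_eq]
  rw [integral_im (hf.integrableOn_of_measure_ne_top hp1 (hμ _ _)), RCLike.smul_im, smul_eq_mul]

theorem ae_tendsto_averageSum_atTop [BorelSpace X] (hμ : ∀ k α, μ (D.cube k α) ≠ ∞)
    (hp1 : 1 ≤ p) (hp : p ≠ ∞) (hf : MemLp f p μ) :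
    ∀ᵐ x ∂μ, Tendsto (fun n : ℤ => D.averageSum μ f n x) atTop (𝓝 (f x)) := by
  have h1 := ae_of_forall_ae_restrict_cube 0
    (ae_restrict_tendsto_averageSum_real hμ hp1 hp hf.re)
  have h2 := ae_of_forall_ae_restrict_cube 0
    (ae_restrict_tendsto_averageSum_real hμ hp1 hp hf.im)
  filter_upwards [h1, h2] with x h1 h2
  simp only [averageSum_re hμ hp1 hf] at h1
  simp only [averageSum_im hμ hp1 hf] at h2
  have h3 := ((RCLike.continuous_ofReal (K := 𝕜)).tendsto _ |>.comp h1).add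
    (((RCLike.continuous_ofReal (K := 𝕜)).tendsto _ |>.comp h2).mul_const RCLike.I)
  rw [RCLike.re_add_im] at h3
  have h4 : Tendsto (fun n : ℕ => D.averageSum μ f n x) atTop (𝓝 (f x)) :=
    h3.congr fun n => RCLike.re_add_im _
  have h5 : Tendsto Int.toNat atTop atTop :=
    tendsto_atTop_atTop.2 fun b => ⟨b, fun a ha => by omega⟩
  refine (h4.comp h5).congr' ?_
  filter_upwards [eventually_ge_atTop 0] with n hn
  simp [Int.toNat_of_nonneg hn]

end DyadicSystem

/-! ### Convergence of the averages in norm -/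

theorem ENNReal.tendsto_zero_of_forall_le_add {ι : Type*} {l : Filter ι} {u : ι → ℝ≥0∞}
    (h : ∀ ε : ℝ≥0∞, 0 < ε → ∃ v : ι → ℝ≥0∞, Tendsto v l (𝓝 0) ∧ ∀ᶠ i in l, u i ≤ v i + ε) :
    Tendsto u l (𝓝 0) := by
  refine ENNReal.tendsto_nhds_zero.2 fun ε hε => ?_
  obtain ⟨v, hv, huv⟩ := h (ε / 2) (ENNReal.half_pos hε.ne')
  filter_upwards [huv, ENNReal.tendsto_nhds_zero.1 hv (ε / 2) (ENNReal.half_pos hε.ne')]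
    with i h1 h2
  calc u i ≤ v i + ε / 2 := h1
    _ ≤ ε / 2 + ε / 2 := by gcongr
    _ = ε := ENNReal.add_halves ε

section globalMean

variable {X 𝕜 : Type*} [MeasurableSpace X] [RCLike 𝕜] {μ : Measure X} {p : ℝ≥0∞} {f g : X → 𝕜}

theorem globalMean_of_lt_top (h : μ Set.univ < ∞) (f : X → 𝕜) :
    globalMean μ f = ⨍ x, f x ∂μ := by
  rw [globalMean, if_pos h, average_eq, RCLike.real_smul_eq_coe_mul]

theorem globalMean_of_eq_top (h : μ Set.univ = ∞) (f : X → 𝕜) : globalMean μ f = 0 := by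
  rw [globalMean, if_neg (by simp [h])]

theorem globalMean_sub (hp1 : 1 ≤ p) (hf : MemLp f p μ) (hg : MemLp g p μ) :
    globalMean μ (fun x => f x - g x) = globalMean μ f - globalMean μ g := by
  by_cases h : μ Set.univ < ∞
  · have : IsFiniteMeasure μ := ⟨h⟩
    simp only [globalMean_of_lt_top h, average_eq]
    rw [integral_sub (hf.integrable hp1) (hg.integrable hp1), smul_sub]
  · simp [globalMean, h]

theorem memLp_globalMean (f : X → 𝕜) : MemLp (fun _ => globalMean μ f) p μ := by
  by_cases h : μ Set.univ < ∞
  · have : IsFiniteMeasure μ := ⟨h⟩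
    exact memLp_const _
  · simp [globalMean, h]

theorem eLpNorm_globalMean_le (hp1 : 1 ≤ p) (hp : p ≠ ∞) (hf : AEStronglyMeasurable f μ) :
    eLpNorm (fun _ => globalMean μ f) p μ ≤ eLpNorm f p μ := by
  have hp0 : p ≠ 0 := (zero_lt_one.trans_le hp1).ne'
  by_cases h : μ Set.univ < ∞
  · have h1 := enorm_setAverage_rpow_mul_le (f := f) hp1 hp h.ne hf.restrict
    rw [Measure.restrict_univ, ← globalMean_of_lt_top h] at h1
    rw [eLpNorm_eq_lintegral_rpow_enorm_toReal hp0 hp,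
      eLpNorm_eq_lintegral_rpow_enorm_toReal hp0 hp, lintegral_const]
    gcongr
  · simp [globalMean, h]

end globalMean

namespace DyadicSystem

variable {X 𝕜 : Type*} [QuasiMetricSpace X] [MeasurableSpace X] [RCLike 𝕜]
  {D : DyadicSystem X} {μ : Measure X} {p : ℝ≥0∞} {f g : X → 𝕜} {x₀ : X}

theorem averageSum_indicator_of_notMem (f : X → 𝕜) {k m : ℤ} (hkm : k ≤ m) {α : D.A k} {x : X}
    (hx : x ∉ D.cube k α) : D.averageSum μ ((D.cube k α).indicator f) m x = 0 := by
  rw [averageSum_eq, setAverage_eq, setIntegral_eq_zero_of_forall_eq_zero, smul_zero]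
  intro y hy
  refine Set.indicator_of_notMem (fun hyα => hx ?_) f
  exact cube_subset_of_mem hkm hyα hy (D.mem_cube_idx m x)

theorem norm_averageSum_le {C : ℝ} (hμ : ∀ k α, μ (D.cube k α) ≠ ∞) (hC : ∀ x, ‖f x‖ ≤ C)
    (m : ℤ) (x : X) : ‖D.averageSum μ f m x‖ ≤ C := by
  have hC0 : 0 ≤ C := (norm_nonneg _).trans (hC x)
  have h := norm_setIntegral_le_of_norm_le_const (f := f) (hμ m (D.idx m x)).lt_top
    (fun y _ => hC y)
  rw [averageSum_eq, setAverage_eq, norm_smul, norm_inv, Real.norm_of_nonneg measureReal_nonneg]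
  rcases (measureReal_nonneg (μ := μ) (s := D.cube m (D.idx m x))).eq_or_lt with h0 | h0
  · rw [← h0]; simpa using hC0
  · rw [inv_mul_le_iff₀ h0]; linarith

theorem tendsto_eLpNorm_indicator_cube (hx₀ : ∀ k : ℤ, ∃ α : D.A k, D.center k α = x₀)
    (hp0 : p ≠ 0) (hp : p ≠ ∞) (hf : MemLp f p μ) :
    Tendsto (fun m : ℤ => eLpNorm
      (fun x => (D.cube m (D.idx m x₀)).indicator f x - f x) p μ) atBot (𝓝 0) := by
  refine tendsto_eLpNorm_sub_of_dominated hp0 hp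
    (fun m => hf.1.indicator (D.measurableSet_cube _ _)) hf.1 hf.norm
    (Eventually.of_forall fun m => ae_of_all _ fun x => ?_) (ae_of_all _ fun x => ?_)
  · by_cases hx : x ∈ D.cube m (D.idx m x₀) <;> simp [hx]
  · obtain ⟨m, hm⟩ := D.exists_forall_mem_cube_idx hx₀ x
    refine tendsto_const_nhds.congr' ?_
    filter_upwards [eventually_le_atBot m] with k hk
    rw [Set.indicator_of_mem (hm k hk)]

theorem exists_eLpNorm_sub_indicator_cube_le
    (hx₀ : ∀ k : ℤ, ∃ α : D.A k, D.center k α = x₀) (hp0 : p ≠ 0) (hp : p ≠ ∞)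
    (hf : MemLp f p μ) {ε : ℝ≥0∞} (hε : 0 < ε) (m₀ : ℤ) : ∃ m ≤ m₀,
      eLpNorm (fun x => f x - (D.cube m (D.idx m x₀)).indicator f x) p μ ≤ ε := by
  have h := ENNReal.tendsto_nhds_zero.1 (tendsto_eLpNorm_indicator_cube hx₀ hp0 hp hf) ε hε
  obtain ⟨m, hm, hm'⟩ := (h.and (eventually_le_atBot m₀)).exists
  refine ⟨m, hm', le_trans (le_of_eq ?_) hm⟩
  exact eLpNorm_sub_comm f _ p μ

theorem tendsto_eLpNorm_averageSum_atTop [BorelSpace X] (hμ : ∀ k α, μ (D.cube k α) ≠ ∞)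
    (hx₀ : ∀ k : ℤ, ∃ α : D.A k, D.center k α = x₀) (hp1 : 1 ≤ p) (hp : p ≠ ∞)
    (hf : MemLp f p μ) :
    Tendsto (fun n : ℤ => eLpNorm (fun x => D.averageSum μ f n x - f x) p μ) atTop (𝓝 0) := by
  have hp0 : p ≠ 0 := (zero_lt_one.trans_le hp1).ne'
  refine ENNReal.tendsto_zero_of_forall_le_add fun ε hε => ?_
  have hε4 : 0 < ε / 2 / 2 := ENNReal.half_pos (ENNReal.half_pos hε.ne').ne'
  -- a bounded function supported in a cube and close to `f`
  obtain ⟨h, hfh, hh⟩ := hf.exists_simpleFunc_eLpNorm_sub_lt hp hε4.ne'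
  obtain ⟨m, -, hm⟩ := exists_eLpNorm_sub_indicator_cube_le hx₀ hp0 hp hh hε4 0
  obtain ⟨C, hC⟩ := h.exists_forall_norm_le
  set K := D.cube m (D.idx m x₀) with hK
  have hKm : MeasurableSet K := D.measurableSet_cube _ _
  set g : X → 𝕜 := K.indicator h with hg
  have hgp : MemLp g p μ := hh.indicator hKm
  have hgC : ∀ x, ‖g x‖ ≤ C := fun x => (norm_indicator_le_norm_self _ _).trans (hC x)
  have hfg : eLpNorm (fun x => f x - g x) p μ ≤ ε / 2 := by
    calc eLpNorm (fun x => f x - g x) p μ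
        = eLpNorm ((fun x => f x - h x) + fun x => h x - g x) p μ := by
          congr 1; ext x; simp
      _ ≤ eLpNorm (fun x => f x - h x) p μ + eLpNorm (fun x => h x - g x) p μ :=
          eLpNorm_add_le (hf.1.sub hh.1) (hh.1.sub hgp.1) hp1
      _ ≤ ε / 2 / 2 + ε / 2 / 2 := add_le_add hfh.le hm
      _ = ε / 2 := ENNReal.add_halves _
  refine ⟨fun n => eLpNorm (fun x => D.averageSum μ g n x - g x) p μ, ?_,
    Eventually.of_forall fun n => ?_⟩
  · refine tendsto_eLpNorm_sub_of_dominated hp0 hp (G := K.indicator fun _ => 2 * C)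
      (fun n => aestronglyMeasurable_averageSum g n) hgp.1
      (memLp_indicator_const p hKm _ (Or.inr (hμ _ _))) ?_
      (ae_tendsto_averageSum_atTop hμ hp1 hp hgp)
    filter_upwards [eventually_ge_atTop m] with n hn
    refine ae_of_all _ fun x => ?_
    by_cases hx : x ∈ K
    · rw [Set.indicator_of_mem hx]
      exact (norm_sub_le _ _).trans
        (by linarith [norm_averageSum_le hμ hgC n x, hgC x])
    · rw [Set.indicator_of_notMem hx, hg, averageSum_indicator_of_notMem _ hn hx,
        Set.indicator_of_notMem hx]
      simp
  · have hsub : MemLp (fun x => f x - g x) p μ := hf.sub hgp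
    calc eLpNorm (fun x => D.averageSum μ f n x - f x) p μ
        = eLpNorm ((fun x => D.averageSum μ g n x - g x) +
            (D.averageSum μ (fun x => f x - g x) n - fun x => f x - g x)) p μ := by
          congr 1; ext x
          simp only [Pi.add_apply, Pi.sub_apply, averageSum_sub hμ hp1 hf hgp]
          ring
      _ ≤ eLpNorm (fun x => D.averageSum μ g n x - g x) p μ +
            eLpNorm (D.averageSum μ (fun x => f x - g x) n - fun x => f x - g x) p μ :=
          eLpNorm_add_le ((aestronglyMeasurable_averageSum g n).sub hgp.1)
            ((aestronglyMeasurable_averageSum _ n).sub hsub.1) hp1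
      _ ≤ eLpNorm (fun x => D.averageSum μ g n x - g x) p μ +
            (eLpNorm (D.averageSum μ (fun x => f x - g x) n) p μ +
              eLpNorm (fun x => f x - g x) p μ) := by
          gcongr
          exact eLpNorm_sub_le (aestronglyMeasurable_averageSum _ n) hsub.1 hp1
      _ ≤ eLpNorm (fun x => D.averageSum μ g n x - g x) p μ + (ε / 2 + ε / 2) := by
          gcongr
          exact (eLpNorm_averageSum_le hμ hp1 hp hsub.1 n).trans hfg
      _ = _ := by rw [ENNReal.add_halves]

theorem tendsto_measure_cube_atBot (hx₀ : ∀ k : ℤ, ∃ α : D.A k, D.center k α = x₀) :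
    Tendsto (fun m : ℤ => μ (D.cube m (D.idx m x₀))) atBot (𝓝 (μ Set.univ)) := by
  have e : (⋃ m : ℤ, D.cube m (D.idx m x₀)) = Set.univ := by
    refine Set.eq_univ_of_forall fun x => ?_
    obtain ⟨m, hm⟩ := D.exists_forall_mem_cube_idx hx₀ x
    exact Set.mem_iUnion.2 ⟨m, hm m le_rfl⟩
  rw [← e]
  exact tendsto_measure_iUnion_atBot fun k l h => D.cube_idx_anti h x₀

theorem tendsto_setAverage_cube_atBot (hμ : ∀ k α, μ (D.cube k α) ≠ ∞)
    (hx₀ : ∀ k : ℤ, ∃ α : D.A k, D.center k α = x₀) (hp1 : 1 ≤ p) (hp : p ≠ ∞)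
    (hf : MemLp f p μ) :
    Tendsto (fun m : ℤ => ⨍ x in D.cube m (D.idx m x₀), f x ∂μ) atBot
      (𝓝 (globalMean μ f)) := by
  have hp0 : p ≠ 0 := (zero_lt_one.trans_le hp1).ne'
  have hp' : 0 < p.toReal := ENNReal.toReal_pos hp0 hp
  have hμK := tendsto_measure_cube_atBot (μ := μ) hx₀
  by_cases h : μ Set.univ < ∞
  · have : IsFiniteMeasure μ := ⟨h⟩
    rcases eq_or_ne (μ Set.univ) 0 with h0 | h0
    · rw [Measure.measure_univ_eq_zero] at h0
      subst h0
      simp [globalMean]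
    simp only [globalMean_of_lt_top h, setAverage_eq]
    simp only [average_eq]
    refine Tendsto.smul ?_ ?_
    · exact ((ENNReal.tendsto_toReal h.ne).comp hμK).inv₀ (ENNReal.toReal_pos h0 h.ne).ne'
    · have hK : ∀ m, MeasurableSet (D.cube m (D.idx m x₀)) := fun m => D.measurableSet_cube _ _
      simp_rw [← integral_indicator (hK _)]
      refine tendsto_integral_filter_of_dominated_convergence (fun x => ‖f x‖)
        (Eventually.of_forall fun m => hf.1.indicator (hK m))
        (Eventually.of_forall fun m => ae_of_all _ fun x => norm_indicator_le_norm_self _ _)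
        (hf.integrable hp1).norm (ae_of_all _ fun x => ?_)
      obtain ⟨m, hm⟩ := D.exists_forall_mem_cube_idx hx₀ x
      refine tendsto_const_nhds.congr' ?_
      filter_upwards [eventually_le_atBot m] with k hk
      rw [Set.indicator_of_mem (hm k hk)]
  · have htop : μ Set.univ = ∞ := not_lt_top_iff.1 h
    rw [globalMean_of_eq_top htop]
    rw [htop] at hμK
    set I : ℝ≥0∞ := ∫⁻ x, ‖f x‖ₑ ^ p.toReal ∂μ with hI
    have hI' : I ≠ ∞ := (lintegral_rpow_enorm_lt_top_of_eLpNorm_lt_top hp0 hp hf.2).ne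
    have h1 : ∀ᶠ m : ℤ in atBot,
        ‖⨍ x in D.cube m (D.idx m x₀), f x ∂μ‖ₑ ≤
          (I / μ (D.cube m (D.idx m x₀))) ^ (1 / p.toReal) := by
      filter_upwards [hμK.eventually (lt_mem_nhds ENNReal.zero_lt_top)] with m hm
      rw [one_div, ENNReal.le_rpow_inv_iff hp', ENNReal.le_div_iff_mul_le (Or.inl hm.ne')
        (Or.inl (hμ _ _))]
      exact (enorm_setAverage_rpow_mul_le hp1 hp (hμ _ _) hf.1.restrict).trans
        (setLIntegral_le_lintegral _ _)
    have h2 : Tendsto (fun m : ℤ => (I / μ (D.cube m (D.idx m x₀))) ^ (1 / p.toReal))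
        atBot (𝓝 0) := by
      have h3 := ENNReal.Tendsto.const_div hμK (Or.inr hI') (a := I)
      have h4 := (ENNReal.continuous_rpow_const (y := 1 / p.toReal)).tendsto _ |>.comp h3
      rwa [ENNReal.div_top, ENNReal.zero_rpow_of_pos (by positivity)] at h4
    rw [tendsto_zero_iff_enorm_tendsto_zero]
    exact tendsto_of_tendsto_of_tendsto_of_le_of_le' tendsto_const_nhds h2
      (Eventually.of_forall fun _ => zero_le) h1

theorem tendsto_averageSum_atBot (hμ : ∀ k α, μ (D.cube k α) ≠ ∞)
    (hx₀ : ∀ k : ℤ, ∃ α : D.A k, D.center k α = x₀) (hp1 : 1 ≤ p) (hp : p ≠ ∞)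
    (hf : MemLp f p μ) (x : X) :
    Tendsto (fun m : ℤ => D.averageSum μ f m x) atBot (𝓝 (globalMean μ f)) := by
  obtain ⟨m, hm⟩ := D.exists_forall_mem_cube_idx hx₀ x
  refine (tendsto_setAverage_cube_atBot hμ hx₀ hp1 hp hf).congr' ?_
  filter_upwards [eventually_le_atBot m] with k hk
  rw [averageSum_of_mem f (hm k hk)]

/-- For a function supported in a cube, the averages over large cubes tend to the global mean in
norm; if the measure is infinite, this rests on `p > 1`. -/
theorem tendsto_eLpNorm_averageSum_indicator_atBot (hμ : ∀ k α, μ (D.cube k α) ≠ ∞)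
    (hx₀ : ∀ k : ℤ, ∃ α : D.A k, D.center k α = x₀) (hp1 : 1 < p) (hp : p ≠ ∞)
    (hf : MemLp f p μ) (m₀ : ℤ) {g : X → 𝕜}
    (hg : g = (D.cube m₀ (D.idx m₀ x₀)).indicator f) :
    Tendsto (fun m : ℤ => eLpNorm (fun x => D.averageSum μ g m x - globalMean μ g) p μ)
      atBot (𝓝 0) := by
  have hp0 : p ≠ 0 := (zero_lt_one.trans hp1).ne'
  have hp' : 1 < p.toReal := by
    rw [← ENNReal.toReal_one]; exact (ENNReal.toReal_lt_toReal ENNReal.one_ne_top hp).2 hp1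
  have hgp : MemLp g p μ := hg ▸ hf.indicator (D.measurableSet_cube _ _)
  set a : ℤ → 𝕜 := fun m => ⨍ x in D.cube m (D.idx m x₀), g x ∂μ with ha
  have hA : ∀ m ≤ m₀, D.averageSum μ g m = (D.cube m (D.idx m x₀)).indicator fun _ => a m := by
    intro m hm
    ext x
    by_cases hx : x ∈ D.cube m (D.idx m x₀)
    · rw [Set.indicator_of_mem hx, averageSum_of_mem g hx]
    · rw [Set.indicator_of_notMem hx, averageSum_eq, setAverage_eq,
        setIntegral_eq_zero_of_forall_eq_zero, smul_zero]
      intro y hy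
      rw [hg, Set.indicator_of_notMem]
      intro hy₀
      refine hx ?_
      rw [eq_of_mem_of_mem (D.cube_idx_anti hm x₀ hy₀) hy]
      exact D.mem_cube_idx m x
  have hlim := tendsto_setAverage_cube_atBot hμ hx₀ hp1.le hp hgp
  by_cases h : μ Set.univ < ∞
  · have : IsFiniteMeasure μ := ⟨h⟩
    refine tendsto_eLpNorm_sub_of_dominated hp0 hp
      (G := fun _ => (‖globalMean μ g‖ + 1) + ‖globalMean μ g‖)
      (fun n => aestronglyMeasurable_averageSum g n) aestronglyMeasurable_const
      (memLp_const _) ?_ (ae_of_all _ (tendsto_averageSum_atBot hμ hx₀ hp1.le hp hgp))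
    filter_upwards [eventually_le_atBot m₀,
      hlim.norm.eventually (gt_mem_nhds (lt_add_one _))] with m hm hm'
    refine ae_of_all _ fun x => (norm_sub_le _ _).trans (add_le_add ?_ le_rfl)
    rw [hA m hm]
    exact (norm_indicator_le_norm_self _ _).trans hm'.le
  · have htop : μ Set.univ = ∞ := not_lt_top_iff.1 h
    have hμK := tendsto_measure_cube_atBot (μ := μ) hx₀
    rw [htop] at hμK
    simp only [globalMean_of_eq_top htop, sub_zero]
    have h2 : Tendsto (fun m : ℤ => ‖∫ x, g x ∂μ‖ₑ *
        μ (D.cube m (D.idx m x₀)) ^ (1 / p.toReal - 1)) atBot (𝓝 0) := by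
      have h3 : Tendsto (fun y : ℝ≥0∞ => y ^ (1 / p.toReal - 1)) (𝓝 ∞) (𝓝 0) := by
        have := (ENNReal.continuous_rpow_const (y := 1 / p.toReal - 1)).tendsto ∞
        rwa [ENNReal.top_rpow_of_neg (by rw [sub_neg, div_lt_one (by linarith)]; exact hp')]
          at this
      have h4 := ENNReal.Tendsto.const_mul (h3.comp hμK) (a := ‖∫ x, g x ∂μ‖ₑ)
        (Or.inr enorm_ne_top)
      rwa [mul_zero] at h4
    refine h2.congr' ?_
    filter_upwards [eventually_le_atBot m₀,
      hμK.eventually (lt_mem_nhds ENNReal.zero_lt_top)] with m hm hpos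
    have hint : ∫ x in D.cube m (D.idx m x₀), g x ∂μ = ∫ x, g x ∂μ := by
      refine setIntegral_eq_integral_of_forall_compl_eq_zero fun x hx => ?_
      rw [hg, Set.indicator_of_notMem fun hx' => hx (D.cube_idx_anti hm x₀ hx')]
    rw [hA m hm, eLpNorm_indicator_const (D.measurableSet_cube _ _) hp0 hp, ha]
    simp only
    rw [setAverage_eq, hint, enorm_smul, Real.enorm_eq_ofReal (by positivity), measureReal_def,
      ENNReal.ofReal_inv_of_pos (ENNReal.toReal_pos hpos.ne' (hμ _ _)),
      ENNReal.ofReal_toReal (hμ _ _), ENNReal.rpow_sub _ _ hpos.ne' (hμ _ _), ENNReal.rpow_one,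
      ENNReal.div_eq_inv_mul]
    ring

theorem tendsto_eLpNorm_averageSum_atBot (hμ : ∀ k α, μ (D.cube k α) ≠ ∞)
    (hx₀ : ∀ k : ℤ, ∃ α : D.A k, D.center k α = x₀) (hp1 : 1 < p) (hp : p ≠ ∞)
    (hf : MemLp f p μ) :
    Tendsto (fun m : ℤ => eLpNorm (fun x => D.averageSum μ f m x - globalMean μ f) p μ)
      atBot (𝓝 0) := by
  have hp0 : p ≠ 0 := (zero_lt_one.trans hp1).ne'
  refine ENNReal.tendsto_zero_of_forall_le_add fun ε hε => ?_
  obtain ⟨m₀, -, hfg⟩ := exists_eLpNorm_sub_indicator_cube_le hx₀ hp0 hp hf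
    (ENNReal.half_pos hε.ne') 0
  set g := (D.cube m₀ (D.idx m₀ x₀)).indicator f with hg
  have hgp : MemLp g p μ := hf.indicator (D.measurableSet_cube _ _)
  have hsub : MemLp (fun x => f x - g x) p μ := hf.sub hgp
  refine ⟨_, tendsto_eLpNorm_averageSum_indicator_atBot hμ hx₀ hp1 hp hf m₀ hg,
    Eventually.of_forall fun m => ?_⟩
  have hm1 := (aestronglyMeasurable_averageSum (D := D) (μ := μ) g m).sub
    (memLp_globalMean (p := p) (μ := μ) g).1
  have hm2 := aestronglyMeasurable_averageSum (D := D) (μ := μ) (fun x => f x - g x) m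
  have hm3 := (memLp_globalMean (p := p) (μ := μ) (fun x => f x - g x)).1
  calc eLpNorm (fun x => D.averageSum μ f m x - globalMean μ f) p μ
      = eLpNorm ((fun x => D.averageSum μ g m x - globalMean μ g) +
          (D.averageSum μ (fun x => f x - g x) m -
            fun _ => globalMean μ fun x => f x - g x)) p μ := by
        congr 1; ext x
        simp only [Pi.add_apply, Pi.sub_apply, averageSum_sub hμ hp1.le hf hgp,
          globalMean_sub hp1.le hf hgp]
        ring
    _ ≤ eLpNorm (fun x => D.averageSum μ g m x - globalMean μ g) p μ +
          eLpNorm (D.averageSum μ (fun x => f x - g x) m -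
            fun _ => globalMean μ fun x => f x - g x) p μ :=
        eLpNorm_add_le hm1 (hm2.sub hm3) hp1.le
    _ ≤ eLpNorm (fun x => D.averageSum μ g m x - globalMean μ g) p μ + (ε / 2 + ε / 2) := by
        gcongr
        refine (eLpNorm_sub_le hm2 hm3 hp1.le).trans (add_le_add ?_ ?_)
        · exact (eLpNorm_averageSum_le hμ hp1.le hp hsub.1 m).trans hfg
        · exact (eLpNorm_globalMean_le hp1.le hp hsub.1).trans hfg
    _ = _ := by rw [ENNReal.add_halves]

end DyadicSystem

/-! ### Haar functions -/

namespace DyadicSystem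

namespace ChildIndexing

variable {X 𝕜 : Type*} [QuasiMetricSpace X] [MeasurableSpace X] [RCLike 𝕜]
  {D : DyadicSystem X} {μ : Measure X} {p : ℝ≥0∞} {f g : X → 𝕜}

theorem measurableSet_subcube (I : D.ChildIndexing μ) (k : ℤ) (α : D.A k)
    (j : Fin (D.numChildren k α)) : MeasurableSet (I.subcube k α j) :=
  D.measurableSet_cube _ _

theorem subcube_subset (I : D.ChildIndexing μ) (k : ℤ) (α : D.A k)
    (j : Fin (D.numChildren k α)) : I.subcube k α j ⊆ D.cube k α :=
  (I.enum k α j).2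

theorem disjoint_subcube (I : D.ChildIndexing μ) (k : ℤ) (α : D.A k) :
    Pairwise (Function.onFun Disjoint (I.subcube k α)) := fun _ _ h =>
  D.disjoint (k + 1) _ _ fun he => h ((I.enum k α).injective (Subtype.ext he))

theorem iUnion_subcube (I : D.ChildIndexing μ) (k : ℤ) (α : D.A k) :
    ⋃ j, I.subcube k α j = D.cube k α := by
  refine Set.Subset.antisymm (Set.iUnion_subset (I.subcube_subset k α)) fun x hx => ?_
  rw [D.children_union k α] at hx
  obtain ⟨β, hβ, hxβ⟩ := Set.mem_iUnion₂.1 hx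
  let c : D.Child k α := ⟨β, hβ⟩
  have hc : (I.enum k α ((I.enum k α).symm c)).1 = β :=
    congrArg Subtype.val ((I.enum k α).apply_symm_apply c)
  exact Set.mem_iUnion.2 ⟨(I.enum k α).symm c, by rw [subcube, hc]; exact hxβ⟩

theorem tail_eq_biUnion (I : D.ChildIndexing μ) (k : ℤ) (α : D.A k) (u : ℕ) :
    I.tail k α u = ⋃ j ∈ Finset.univ.filter (fun j : Fin (D.numChildren k α) => u ≤ (j : ℕ)),
      I.subcube k α j := by
  simp [tail]

theorem measurableSet_tail (I : D.ChildIndexing μ) (k : ℤ) (α : D.A k) (u : ℕ) :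
    MeasurableSet (I.tail k α u) := by
  rw [tail_eq_biUnion]
  exact Finset.measurableSet_biUnion _ fun j _ => I.measurableSet_subcube k α j

theorem tail_zero (I : D.ChildIndexing μ) (k : ℤ) (α : D.A k) :
    I.tail k α 0 = D.cube k α := by
  simp [tail, iUnion_subcube]

theorem tail_subset (I : D.ChildIndexing μ) (k : ℤ) (α : D.A k) (u : ℕ) :
    I.tail k α u ⊆ D.cube k α :=
  Set.iUnion₂_subset fun j _ => I.subcube_subset k α j

theorem mem_tail_iff (I : D.ChildIndexing μ) {k : ℤ} {α : D.A k} {j : Fin (D.numChildren k α)}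
    {x : X} (hx : x ∈ I.subcube k α j) (u : ℕ) : x ∈ I.tail k α u ↔ u ≤ (j : ℕ) := by
  simp only [tail, Set.mem_iUnion]
  refine ⟨?_, fun h => ⟨j, h, hx⟩⟩
  rintro ⟨i, hi, hxi⟩
  rcases eq_or_ne i j with rfl | hij
  · exact hi
  · exact absurd hx (Set.disjoint_left.1 (I.disjoint_subcube k α hij) hxi)

theorem mem_subcube_iff (I : D.ChildIndexing μ) {k : ℤ} {α : D.A k}
    {j : Fin (D.numChildren k α)} {x : X} (hx : x ∈ I.subcube k α j)
    (i : Fin (D.numChildren k α)) : x ∈ I.subcube k α i ↔ i = j := by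
  refine ⟨fun hxi => ?_, fun h => h ▸ hx⟩
  by_contra hij
  exact Set.disjoint_left.1 (I.disjoint_subcube k α hij) hxi hx

theorem sum_filter_le_eq_sum_Ico {E : Type*} [AddCommMonoid E] {M : ℕ} (H : Fin M → E) (u : ℕ) :
    ∑ j ∈ Finset.univ.filter (fun j : Fin M => u ≤ (j : ℕ)), H j
      = ∑ j ∈ Finset.Ico u M, if h : j < M then H ⟨j, h⟩ else 0 := by
  rw [Finset.sum_filter]
  have h := Fin.sum_univ_eq_sum_range
    (fun j => if u ≤ j then (if h : j < M then H ⟨j, h⟩ else 0) else 0) M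
  simp only [Fin.is_lt, dite_true, Fin.eta] at h
  rw [h, ← Finset.sum_filter]
  refine Finset.sum_congr ?_ fun _ _ => rfl
  ext j
  simp only [Finset.mem_filter, Finset.mem_range, Finset.mem_Ico]
  tauto

/-- The mass of the child number `j`, and `0` for `j ≥ M_Q`. -/
def childMass (I : D.ChildIndexing μ) (k : ℤ) (α : D.A k) (j : ℕ) : ℝ :=
  if h : j < D.numChildren k α then μ.real (I.subcube k α ⟨j, h⟩) else 0

/-- The integral over the child number `j`, and `0` for `j ≥ M_Q`. -/
def childIntegral (I : D.ChildIndexing μ) (f : X → 𝕜) (k : ℤ) (α : D.A k) (j : ℕ) : 𝕜 :=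
  if h : j < D.numChildren k α then ∫ x in I.subcube k α ⟨j, h⟩, f x ∂μ else 0

theorem measureReal_tail (I : D.ChildIndexing μ) (hμ : ∀ k α, μ (D.cube k α) ≠ ∞) (k : ℤ)
    (α : D.A k) (u : ℕ) :
    μ.real (I.tail k α u) = ∑ j ∈ Finset.Ico u (D.numChildren k α), I.childMass k α j := by
  rw [tail_eq_biUnion, measureReal_biUnion_finset
    (fun i _ j _ h => I.disjoint_subcube k α h)
    (fun j _ => I.measurableSet_subcube k α j) (fun j _ => hμ _ _), sum_filter_le_eq_sum_Ico]
  rfl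

theorem setIntegral_tail (I : D.ChildIndexing μ) {k : ℤ} {α : D.A k}
    (hf : IntegrableOn f (D.cube k α) μ) (u : ℕ) :
    ∫ x in I.tail k α u, f x ∂μ
      = ∑ j ∈ Finset.Ico u (D.numChildren k α), I.childIntegral f k α j := by
  rw [tail_eq_biUnion, integral_biUnion_finset _ (fun j _ => I.measurableSet_subcube k α j)
    (fun i _ j _ h => I.disjoint_subcube k α h)
    (fun j _ => hf.mono_set (I.subcube_subset k α j)), sum_filter_le_eq_sum_Ico]
  rfl

theorem pairing_haar (I : D.ChildIndexing μ) {k : ℤ} {α : D.A k}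
    (hf : IntegrableOn f (D.cube k α) μ) (u : Fin (D.numChildren k α - 1)) :
    pairing μ f (I.haar k α u) =
      if μ (I.subcube k α ⟨u, by omega⟩) = 0 then 0 else
      ((√(μ.real (I.tail k α (u + 1))) / (√(μ.real (I.subcube k α ⟨u, by omega⟩)) *
        √(μ.real (I.tail k α u))) : ℝ) : 𝕜) * ∫ x in I.subcube k α ⟨u, by omega⟩, f x ∂μ
      - ((√(μ.real (I.subcube k α ⟨u, by omega⟩)) / (√(μ.real (I.tail k α u)) *
        √(μ.real (I.tail k α (u + 1)))) : ℝ) : 𝕜) * ∫ x in I.tail k α (u + 1), f x ∂μ := by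
  have hQ := I.measurableSet_subcube k α ⟨u, by omega⟩
  have hE := I.measurableSet_tail k α (u + 1)
  split_ifs with h0
  · simp [pairing, haar, h0]
  · have i1 : Integrable ((I.subcube k α ⟨u, by omega⟩).indicator f) μ :=
      (hf.mono_set (I.subcube_subset k α _)).integrable_indicator hQ
    have i2 : Integrable ((I.tail k α (u + 1)).indicator f) μ :=
      (hf.mono_set (I.tail_subset k α _)).integrable_indicator hE
    rw [← integral_indicator hQ, ← integral_indicator hE, ← integral_const_mul,
      ← integral_const_mul, ← integral_sub (i1.const_mul _) (i2.const_mul _), pairing]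
    congr 1
    ext x
    classical
    simp only [haar, if_neg h0, Set.indicator_apply]
    split_ifs <;> push_cast <;> ring

theorem integrableOn_cube (hμ : ∀ k α, μ (D.cube k α) ≠ ∞) (hp1 : 1 ≤ p) (hf : MemLp f p μ)
    (k : ℤ) (α : D.A k) : IntegrableOn f (D.cube k α) μ :=
  hf.integrableOn_of_measure_ne_top hp1 (hμ k α)

theorem haarTerm_sub (I : D.ChildIndexing μ) (hμ : ∀ k α, μ (D.cube k α) ≠ ∞) (hp1 : 1 ≤ p)
    (hf : MemLp f p μ) (hg : MemLp g p μ) (i : D.HaarIndex) (x : X) :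
    I.haarTerm (fun y => f y - g y) i x = I.haarTerm f i x - I.haarTerm g i x := by
  obtain ⟨k, α, u⟩ := i
  have hf' := integrableOn_cube hμ hp1 hf k α
  have hg' := integrableOn_cube hμ hp1 hg k α
  simp only [haarTerm]
  rw [I.pairing_haar (f := fun y => f y - g y) (hf'.sub hg'), I.pairing_haar hf',
    I.pairing_haar hg',
    integral_sub (hf'.mono_set (I.subcube_subset k α _)) (hg'.mono_set (I.subcube_subset k α _)),
    integral_sub (hf'.mono_set (I.tail_subset k α _)) (hg'.mono_set (I.tail_subset k α _))]
  split_ifs <;> ring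

theorem haarTerm_re (I : D.ChildIndexing μ) (hμ : ∀ k α, μ (D.cube k α) ≠ ∞) (hp1 : 1 ≤ p)
    (hf : MemLp f p μ) (i : D.HaarIndex) (x : X) :
    I.haarTerm (fun y => RCLike.re (f y)) i x = RCLike.re (I.haarTerm f i x) := by
  obtain ⟨k, α, u⟩ := i
  have hf' := integrableOn_cube hμ hp1 hf k α
  simp only [haarTerm]
  rw [I.pairing_haar hf'.re, I.pairing_haar hf',
    integral_re (hf'.mono_set (I.subcube_subset k α _)),
    integral_re (hf'.mono_set (I.tail_subset k α _))]
  split_ifs <;> simp only [map_sub, RCLike.re_mul_ofReal, RCLike.re_ofReal_mul, map_zero, zero_mul,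
    RCLike.ofReal_real_eq_id, id]

theorem haarTerm_im (I : D.ChildIndexing μ) (hμ : ∀ k α, μ (D.cube k α) ≠ ∞) (hp1 : 1 ≤ p)
    (hf : MemLp f p μ) (i : D.HaarIndex) (x : X) :
    I.haarTerm (fun y => RCLike.im (f y)) i x = RCLike.im (I.haarTerm f i x) := by
  obtain ⟨k, α, u⟩ := i
  have hf' := integrableOn_cube hμ hp1 hf k α
  simp only [haarTerm]
  rw [I.pairing_haar hf'.im, I.pairing_haar hf',
    integral_im (hf'.mono_set (I.subcube_subset k α _)),
    integral_im (hf'.mono_set (I.tail_subset k α _))]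
  split_ifs <;> simp only [map_sub, RCLike.im_mul_ofReal, RCLike.im_ofReal_mul, map_zero, zero_mul,
    RCLike.ofReal_real_eq_id, id]

theorem measureReal_tail_eq_add (I : D.ChildIndexing μ) (hμ : ∀ k α, μ (D.cube k α) ≠ ∞) {k : ℤ}
    {α : D.A k} {u : ℕ} (hu : u < D.numChildren k α) :
    μ.real (I.tail k α u) = μ.real (I.subcube k α ⟨u, hu⟩) + μ.real (I.tail k α (u + 1)) := by
  rw [I.measureReal_tail hμ, I.measureReal_tail hμ, Finset.sum_eq_sum_Ico_succ_bot hu, childMass,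
    dif_pos hu]

theorem setIntegral_tail_eq_add (I : D.ChildIndexing μ) {k : ℤ} {α : D.A k}
    (hf : IntegrableOn f (D.cube k α) μ) {u : ℕ} (hu : u < D.numChildren k α) :
    ∫ x in I.tail k α u, f x ∂μ
      = ∫ x in I.subcube k α ⟨u, hu⟩, f x ∂μ + ∫ x in I.tail k α (u + 1), f x ∂μ := by
  rw [I.setIntegral_tail hf, I.setIntegral_tail hf, Finset.sum_eq_sum_Ico_succ_bot hu,
    childIntegral, dif_pos hu]

/-- The cancellative Haar functions of a cube are orthogonal to functions that are constant on the
cube. -/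
theorem haarTerm_eq_zero_of_const (I : D.ChildIndexing μ) (hμ : ∀ k α, μ (D.cube k α) ≠ ∞)
    (i : D.HaarIndex) {c : 𝕜} (hc : ∀ y ∈ D.cube i.1 i.2.1, f y = c) (x : X) :
    I.haarTerm f i x = 0 := by
  obtain ⟨k, α, u⟩ := i
  have hf' : IntegrableOn f (D.cube k α) μ :=
    (integrableOn_const (hs := hμ k α)).congr_fun (fun y hy => (hc y hy).symm)
      (D.measurableSet_cube k α)
  have hconst : ∀ {s : Set X}, MeasurableSet s → s ⊆ D.cube k α →
      ∫ y in s, f y ∂μ = ((μ.real s : ℝ) : 𝕜) * c := by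
    intro s hs hsub
    rw [setIntegral_congr_fun hs (fun y hy => hc y (hsub hy)), setIntegral_const,
      RCLike.real_smul_eq_coe_mul]
  simp only [haarTerm]
  rw [I.pairing_haar hf', hconst (I.measurableSet_subcube k α _) (I.subcube_subset k α _),
    hconst (I.measurableSet_tail k α _) (I.tail_subset k α _)]
  split_ifs with h0
  · simp
  · set a := μ.real (I.subcube k α ⟨u, by omega⟩) with ha
    set b := μ.real (I.tail k α (u + 1)) with hb
    set e := μ.real (I.tail k α u)
    have key : √b / (√a * √e) * a - √a / (√e * √b) * b = 0 := by
      have ha' : √a * √a = a := Real.mul_self_sqrt measureReal_nonneg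
      have hb' : √b * √b = b := Real.mul_self_sqrt measureReal_nonneg
      generalize √a = A at ha' ⊢
      generalize √b = B at hb' ⊢
      rw [← ha', ← hb']
      rcases eq_or_ne A 0 with rfl | hA
      · simp
      rcases eq_or_ne B 0 with rfl | hB
      · simp
      rcases eq_or_ne (√e) 0 with he | he
      · simp [he]
      field_simp
      ring
    rw [← mul_assoc, ← mul_assoc, ← sub_mul, ← RCLike.ofReal_mul, ← RCLike.ofReal_mul,
      ← RCLike.ofReal_sub, key]
    simp

/-- Products of the coefficients of a Haar function, where `a = μ(Q_u)` and `b = μ(E_{u+1})`. For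
`b = 0` the coefficient with `√b` in the denominator is `0`. -/
theorem haar_coeff_identities {a b : ℝ} (ha : 0 < a) (hb : 0 ≤ b) :
    √b / (√a * √(a + b)) * (√b / (√a * √(a + b))) = a⁻¹ - (a + b)⁻¹ ∧
    (0 < b → √b / (√a * √(a + b)) * (√a / (√(a + b) * √b)) = (a + b)⁻¹) ∧
    (0 < b → √a / (√(a + b) * √b) * (√a / (√(a + b) * √b)) = b⁻¹ - (a + b)⁻¹) := by
  have he : 0 < a + b := by linarith
  have hA := Real.sqrt_pos.2 ha
  have hE := Real.sqrt_pos.2 he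
  have hA2 : √a ^ 2 = a := Real.sq_sqrt ha.le
  have hB2 : √b ^ 2 = b := Real.sq_sqrt hb
  have hE2 : √(a + b) ^ 2 = a + b := Real.sq_sqrt he.le
  refine ⟨?_, fun hb' => ?_, fun hb' => ?_⟩
  · rw [div_mul_div_comm, ← sq, ← sq, mul_pow, hA2, hB2, hE2]
    field_simp; ring
  · have hB := Real.sqrt_pos.2 hb'
    field_simp
    linarith
  · rw [div_mul_div_comm, ← sq, ← sq, mul_pow, hA2, hB2, hE2]
    field_simp; ring

/-- The value on the child number `j` of the martingale difference of the cut that splits the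
child number `v` off the tail `E_v`: zero if the child was split off before, and otherwise the
average over the part of `E_v` that contains the child minus the average over `E_v`. -/
def increment (I : D.ChildIndexing μ) (f : X → 𝕜) (k : ℤ) (α : D.A k) (v j : ℕ) : 𝕜 :=
  if j < v then 0 else
    (if v < j then ⨍ x in I.tail k α (v + 1), f x ∂μ
      else if h : j < D.numChildren k α then ⨍ x in I.subcube k α ⟨j, h⟩, f x ∂μ else 0)
    - ⨍ x in I.tail k α v, f x ∂μ

/-- On a child of positive measure, the Haar term is the martingale difference of one splitting. -/
theorem haarTerm_eq_increment (I : D.ChildIndexing μ) (hμ : ∀ k α, μ (D.cube k α) ≠ ∞) {k : ℤ}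
    {α : D.A k} (hf : IntegrableOn f (D.cube k α) μ) (u : Fin (D.numChildren k α - 1))
    {j : Fin (D.numChildren k α)} (hj : μ (I.subcube k α j) ≠ 0) {x : X}
    (hx : x ∈ I.subcube k α j) :
    I.haarTerm f ⟨k, α, u⟩ x = I.increment f k α u j := by
  have huM : (u : ℕ) < D.numChildren k α := by omega
  have hQ : x ∈ I.subcube k α ⟨u, huM⟩ ↔ (u : ℕ) = j := by
    rw [I.mem_subcube_iff hx, Fin.ext_iff]
  have hE : x ∈ I.tail k α (u + 1) ↔ (u : ℕ) < j := I.mem_tail_iff hx _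
  have hTe := I.measureReal_tail_eq_add hμ huM
  have hGe := I.setIntegral_tail_eq_add hf huM
  have hnull : ∀ {s : Set X}, μ.real s = 0 → s ⊆ D.cube k α → ∫ y in s, f y ∂μ = 0 := by
    intro s hs hsub
    rw [measureReal_eq_zero_iff (measure_ne_top_of_subset hsub (hμ k α))] at hs
    exact setIntegral_measure_zero _ hs
  have hFa0 := fun h => hnull (s := I.subcube k α ⟨u, huM⟩) h (I.subcube_subset k α _)
  have hFb0 := fun h => hnull (s := I.tail k α (u + 1)) h (I.tail_subset k α _)
  have hjpos : 0 < μ.real (I.subcube k α j) :=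
    ENNReal.toReal_pos hj (measure_ne_top_of_subset (I.subcube_subset k α j) (hμ k α))
  have hbpos : (u : ℕ) < j → 0 < μ.real (I.tail k α (u + 1)) := fun h =>
    hjpos.trans_le (measureReal_mono (fun y hy => (I.mem_tail_iff hy _).2 h)
      (measure_ne_top_of_subset (I.tail_subset k α _) (hμ k α)))
  have hiff : μ (I.subcube k α ⟨u, huM⟩) = 0 ↔ μ.real (I.subcube k α ⟨u, huM⟩) = 0 :=
    (measureReal_eq_zero_iff
      (measure_ne_top_of_subset (I.subcube_subset k α _) (hμ k α))).symm
  have ha0 : 0 ≤ μ.real (I.subcube k α ⟨u, huM⟩) := measureReal_nonneg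
  have hb0 : 0 ≤ μ.real (I.tail k α (u + 1)) := measureReal_nonneg
  rw [increment]
  simp only [haarTerm]
  rw [I.pairing_haar hf]
  classical
  simp only [haar, Set.indicator_apply, hQ, hE, setAverage_eq, hTe, hGe, hiff,
    RCLike.real_smul_eq_coe_mul]
  have haj : (u : ℕ) = j → 0 < μ.real (I.subcube k α ⟨u, huM⟩) := by
    rintro h
    obtain rfl : (⟨u, huM⟩ : Fin _) = j := Fin.ext h
    exact hjpos
  have hAj : (u : ℕ) = j → I.subcube k α j = I.subcube k α ⟨u, huM⟩ := by
    rintro h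
    obtain rfl : (⟨u, huM⟩ : Fin _) = j := Fin.ext h
    rfl
  rcases lt_trichotomy (u : ℕ) j with h | h | h
  · rw [if_neg (not_lt.2 h.le), if_pos h, if_neg h.ne, if_pos h]
    rcases ha0.eq_or_lt with h0 | h0
    · rw [← h0, hFa0 h0.symm]
      simp
    · obtain ⟨-, c2, c3⟩ := haar_coeff_identities h0 hb0
      have c2' := congrArg (RCLike.ofReal (K := 𝕜)) (c2 (hbpos h))
      have c3' := congrArg (RCLike.ofReal (K := 𝕜)) (c3 (hbpos h))
      rw [RCLike.ofReal_mul] at c2' c3'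
      rw [RCLike.ofReal_sub] at c3'
      rw [if_neg h0.ne', if_neg h0.ne', mul_zero, mul_one, zero_sub, RCLike.ofReal_neg]
      linear_combination (-∫ y in I.subcube k α ⟨u, huM⟩, f y ∂μ) * c2' +
        (∫ y in I.tail k α (u + 1), f y ∂μ) * c3'
  · have h0 := haj h
    obtain ⟨c1, c2, -⟩ := haar_coeff_identities h0 hb0
    have c1' := congrArg (RCLike.ofReal (K := 𝕜)) c1
    rw [RCLike.ofReal_mul, RCLike.ofReal_sub] at c1'
    rw [if_neg h.not_lt, if_pos h, if_neg h.not_gt, if_neg h.not_lt, dif_pos j.2, Fin.eta,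
      hAj h, if_neg h0.ne', if_neg h0.ne', mul_zero, mul_one, sub_zero]
    rcases hb0.eq_or_lt with hb | hb
    · rw [hFb0 hb.symm, ← hb]
      rw [← hb] at c1'
      linear_combination (∫ y in I.subcube k α ⟨u, huM⟩, f y ∂μ) * c1'
    · have c2' := congrArg (RCLike.ofReal (K := 𝕜)) (c2 hb)
      rw [RCLike.ofReal_mul] at c2'
      linear_combination (∫ y in I.subcube k α ⟨u, huM⟩, f y ∂μ) * c1' -
        (∫ y in I.tail k α (u + 1), f y ∂μ) * c2'
  · rw [if_pos h, if_neg h.ne', if_neg h.not_gt]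
    simp

end ChildIndexing

end DyadicSystem

/-! ### Sums over generations -/

namespace DyadicSystem

variable {X 𝕜 : Type*} [QuasiMetricSpace X] [MeasurableSpace X] [RCLike 𝕜]
  {D : DyadicSystem X} {μ : Measure X} {p : ℝ≥0∞} {f g : X → 𝕜}

theorem ae_measure_cube_idx_ne_zero (D : DyadicSystem X) (μ : Measure X) :
    ∀ᵐ x ∂μ, ∀ k : ℤ, μ (D.cube k (D.idx k x)) ≠ 0 := by
  rw [ae_all_iff]
  intro k
  have := D.countable_A k
  have h : μ (⋃ α ∈ {α : D.A k | μ (D.cube k α) = 0}, D.cube k α) = 0 :=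
    (measure_biUnion_null_iff (Set.to_countable _)).2 fun α hα => hα
  refine measure_mono_null (fun x hx => ?_) h
  exact Set.mem_biUnion (x := D.idx k x) (not_not.1 hx) (D.mem_cube_idx k x)

namespace ChildIndexing

theorem tail_last (I : D.ChildIndexing μ) {k : ℤ} {α : D.A k} {v : ℕ}
    (hv : v + 1 = D.numChildren k α) : I.tail k α v = I.subcube k α ⟨v, by omega⟩ := by
  ext x
  simp only [tail, Set.mem_iUnion]
  constructor
  · rintro ⟨i, hi, hx⟩
    have hi' : i = ⟨v, by omega⟩ := Fin.ext (by have := i.2; simp only; omega)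
    exact hi' ▸ hx
  · exact fun hx => ⟨_, le_rfl, hx⟩

/-- The last tail consists of a single child, so the last cut does nothing. -/
theorem increment_last (I : D.ChildIndexing μ) (f : X → 𝕜) {k : ℤ} {α : D.A k} {v : ℕ}
    (hv : v + 1 = D.numChildren k α) (j : Fin (D.numChildren k α)) :
    I.increment f k α v j = 0 := by
  rcases lt_or_ge (j : ℕ) v with h | h
  · rw [increment, if_pos h]
  · have hj : (j : ℕ) = v := by have := j.2; omega
    rw [increment, if_neg (by omega), if_neg (by omega), dif_pos j.2, I.tail_last hv]
    simp only [hj, sub_self]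

theorem sum_fin_mul_increment (I : D.ChildIndexing μ) (f : X → 𝕜) {k : ℤ} {α : D.A k}
    (θ : ℕ → 𝕜) (j : Fin (D.numChildren k α)) :
    ∑ u : Fin (D.numChildren k α - 1), θ u * I.increment f k α u j
      = ∑ v ∈ Finset.range (D.numChildren k α), θ v * I.increment f k α v j := by
  have hM : D.numChildren k α - 1 + 1 = D.numChildren k α :=
    Nat.sub_add_cancel (D.numChildren_pos k α)
  have h : ∀ φ : ℕ → 𝕜, φ (D.numChildren k α - 1) = 0 →
      ∑ v ∈ Finset.range (D.numChildren k α - 1), φ v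
        = ∑ v ∈ Finset.range (D.numChildren k α), φ v := by
    intro φ h
    conv_rhs => rw [← hM, Finset.sum_range_succ, h, add_zero]
  rw [Fin.sum_univ_eq_sum_range (fun v => θ v * I.increment f k α v j)]
  exact h _ (by rw [I.increment_last f hM j, mul_zero])

theorem sum_increment (I : D.ChildIndexing μ) (f : X → 𝕜) {k : ℤ} {α : D.A k}
    (j : Fin (D.numChildren k α)) :
    ∑ v ∈ Finset.range (D.numChildren k α), I.increment f k α v j
      = ⨍ x in I.subcube k α j, f x ∂μ - ⨍ x in D.cube k α, f x ∂μ := by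
  rw [← Finset.sum_subset (Finset.range_subset_range.2 (Nat.succ_le_of_lt j.2)),
    Finset.sum_range_succ]
  · have h1 : ∑ v ∈ Finset.range j, I.increment f k α v j
        = ∑ v ∈ Finset.range j, (⨍ x in I.tail k α (v + 1), f x ∂μ -
          ⨍ x in I.tail k α v, f x ∂μ) := by
      refine Finset.sum_congr rfl fun v hv => ?_
      have hv' := Finset.mem_range.1 hv
      rw [increment, if_neg (by omega), if_pos hv']
    rw [h1, Finset.sum_range_sub (fun v => ⨍ x in I.tail k α v, f x ∂μ), I.tail_zero, increment,
      if_neg (lt_irrefl _), if_neg (lt_irrefl _), dif_pos j.2]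
    ring
  · intro v _ hv
    rw [increment, if_pos (by rw [Finset.mem_range] at hv; omega)]

theorem exists_mem_subcube (I : D.ChildIndexing μ) {k : ℤ} {α : D.A k} {x : X}
    (hx : x ∈ D.cube k α) : ∃ j, x ∈ I.subcube k α j := by
  rw [← I.iUnion_subcube] at hx
  exact Set.mem_iUnion.1 hx

theorem generationSum_eq (I : D.ChildIndexing μ) (f : X → 𝕜) (k : ℤ) (x : X) :
    I.generationSum f k x
      = ∑ u : Fin (D.numChildren k (D.idx k x) - 1), I.haarTerm f ⟨k, D.idx k x, u⟩ x := by
  rw [generationSum, tsum_eq_single (D.idx k x)]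
  intro β hβ
  exact Finset.sum_eq_zero fun u _ =>
    I.haarTerm_eq_zero f ⟨k, β, u⟩ fun h => hβ (idx_eq h).symm

/-- The sum over a generation is the difference of consecutive averages. -/
theorem generationSum_eq_sub (I : D.ChildIndexing μ) (hμ : ∀ k α, μ (D.cube k α) ≠ ∞)
    (hp1 : 1 ≤ p) (hf : MemLp f p μ) {k : ℤ} {x : X}
    (hx : μ (D.cube (k + 1) (D.idx (k + 1) x)) ≠ 0) :
    I.generationSum f k x = D.averageSum μ f (k + 1) x - D.averageSum μ f k x := by
  obtain ⟨j, hj⟩ := I.exists_mem_subcube (D.mem_cube_idx k x)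
  have hj0 : μ (I.subcube k (D.idx k x) j) ≠ 0 := by
    rw [subcube, ← idx_eq (α := (I.enum k (D.idx k x) j).1) hj]
    exact hx
  rw [averageSum_of_mem (α := (I.enum k (D.idx k x) j).1) f hj, averageSum_eq, generationSum_eq]
  refine Eq.trans ?_ (I.sum_increment f j)
  have h := I.sum_fin_mul_increment f (fun _ => 1) j
  simp only [one_mul] at h
  rw [← h]
  exact Finset.sum_congr rfl fun u _ =>
    I.haarTerm_eq_increment hμ (integrableOn_cube hμ hp1 hf _ _) u hj0 hj

theorem sum_Ico_generationSum (I : D.ChildIndexing μ) (hμ : ∀ k α, μ (D.cube k α) ≠ ∞)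
    (hp1 : 1 ≤ p) (hf : MemLp f p μ) {x : X} (hx : ∀ k : ℤ, μ (D.cube k (D.idx k x)) ≠ 0)
    {m n : ℤ} (hmn : m ≤ n) :
    ∑ k ∈ Finset.Ico m n, I.generationSum f k x
      = D.averageSum μ f n x - D.averageSum μ f m x := by
  induction n, hmn using Int.leInduction with
  | base => simp
  | succ n h ih =>
    have e : Finset.Ico m (n + 1) = insert n (Finset.Ico m n) := by
      ext i; simp only [Finset.mem_Ico, Finset.mem_insert]; omega
    rw [e, Finset.sum_insert (by simp), ih, I.generationSum_eq_sub hμ hp1 hf (hx _)]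
    ring

open Classical in
/-- At a point of the cube `α`, only the indices of this cube contribute to generation `k`. -/
theorem sum_filter_generation (I : D.ChildIndexing μ) (f : X → 𝕜) (s : Finset D.HaarIndex)
    {k : ℤ} {α : D.A k} {x : X} (hx : x ∈ D.cube k α) :
    ∑ i ∈ s.filter (fun i => i.1 = k), I.haarTerm f i x
      = ∑ u : Fin (D.numChildren k α - 1),
          if (⟨k, α, u⟩ : D.HaarIndex) ∈ s then I.haarTerm f ⟨k, α, u⟩ x else 0 := by
  set t : Finset D.HaarIndex := Finset.univ.image
    (fun u : Fin (D.numChildren k α - 1) => (⟨k, α, u⟩ : D.HaarIndex)) with ht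
  have h1 : ∑ u : Fin (D.numChildren k α - 1),
      (if (⟨k, α, u⟩ : D.HaarIndex) ∈ s then I.haarTerm f ⟨k, α, u⟩ x else 0)
      = ∑ i ∈ t, if i ∈ s then I.haarTerm f i x else 0 := by
    rw [ht, Finset.sum_image]
    intro u _ v _ h
    simpa using h
  rw [h1, ← Finset.sum_filter]
  symm
  refine Finset.sum_subset ?_ ?_
  · intro i hi
    obtain ⟨hit, his⟩ := Finset.mem_filter.1 hi
    obtain ⟨u, -, rfl⟩ := Finset.mem_image.1 hit
    exact Finset.mem_filter.2 ⟨his, rfl⟩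
  · rintro ⟨k', β, u⟩ hi hit
    obtain ⟨his, rfl⟩ := Finset.mem_filter.1 hi
    refine I.haarTerm_eq_zero f _ fun hxβ => hit ?_
    obtain rfl : β = α := eq_of_mem_of_mem hxβ hx
    exact Finset.mem_filter.2 ⟨Finset.mem_image.2 ⟨u, Finset.mem_univ _, rfl⟩, his⟩

/-- The partial sum over the indices in `s` of generation `k, …, k + N - 1`. -/
def partialSum (I : D.ChildIndexing μ) (f : X → 𝕜) (s : Finset D.HaarIndex) (k : ℤ) (N : ℕ)
    (x : X) : 𝕜 :=
  ∑ i ∈ s.filter (fun i => k ≤ i.1 ∧ i.1 < k + N), I.haarTerm f i x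

theorem partialSum_succ (I : D.ChildIndexing μ) (f : X → 𝕜) (s : Finset D.HaarIndex) (k : ℤ)
    (N : ℕ) (x : X) :
    I.partialSum f s k (N + 1) x
      = ∑ i ∈ s.filter (fun i => i.1 = k), I.haarTerm f i x + I.partialSum f s (k + 1) N x := by
  classical
  rw [partialSum, partialSum, ← Finset.sum_union]
  · congr 1
    ext i
    simp only [Finset.mem_filter, Finset.mem_union]
    push_cast
    constructor
    · rintro ⟨h1, h2, h3⟩
      rcases h2.eq_or_lt with h | h
      · exact Or.inl ⟨h1, h.symm⟩
      · exact Or.inr ⟨h1, by omega, by omega⟩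
    · rintro (⟨h1, h2⟩ | ⟨h1, h2, h3⟩)
      · exact ⟨h1, by omega, by omega⟩
      · exact ⟨h1, by omega, by omega⟩
  · rw [Finset.disjoint_filter]
    rintro i - h1 ⟨h2, -⟩
    omega

/-- The integral of `burkholderFun` along a martingale transform of the averages does not increase
when one passes to finer generations. The value `y` is the part of the transform that comes from
the generations before `k`; the induction on `N` splits off the coarsest generation. -/
theorem setIntegral_burkholderFun_le (I : D.ChildIndexing μ) (hμ : ∀ k α, μ (D.cube k α) ≠ ∞)
    {f : X → ℝ} (hf : ∀ k α, IntegrableOn f (D.cube k α) μ) {q : ℝ} (hq : 1 < q)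
    (s : Finset D.HaarIndex) (N : ℕ) : ∀ (k : ℤ) (α : D.A k) (y : ℝ),
    IntegrableOn (fun x => burkholderFun q (y + I.partialSum f s k N x)
        (D.averageSum μ f (k + N) x - (y + I.partialSum f s k N x))) (D.cube k α) μ ∧
      ∫ x in D.cube k α, burkholderFun q (y + I.partialSum f s k N x)
        (D.averageSum μ f (k + N) x - (y + I.partialSum f s k N x)) ∂μ
      ≤ μ.real (D.cube k α) * burkholderFun q y (⨍ x in D.cube k α, f x ∂μ - y) := by
  classical
  induction N with
  | zero =>
    intro k α y
    have h0 : ∀ x, I.partialSum f s k 0 x = 0 := by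
      intro x
      rw [partialSum, Finset.filter_false_of_mem, Finset.sum_empty]
      rintro i -
      push_cast
      omega
    have e : ∀ x ∈ D.cube k α, burkholderFun q (y + I.partialSum f s k 0 x)
        (D.averageSum μ f (k + (0 : ℕ)) x - (y + I.partialSum f s k 0 x))
        = burkholderFun q y (⨍ x in D.cube k α, f x ∂μ - y) := by
      intro x hx
      rw [h0, add_zero, Nat.cast_zero, add_zero, averageSum_of_mem f hx]
    refine ⟨(integrableOn_const (hs := hμ k α)).congr_fun (fun x hx => (e x hx).symm)
      (D.measurableSet_cube k α), le_of_eq ?_⟩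
    rw [setIntegral_congr_fun (D.measurableSet_cube k α) e, setIntegral_const, smul_eq_mul]
  | succ N ih =>
    intro k α y
    set M := D.numChildren k α with hM
    set θ : ℕ → ℝ := fun v => if h : v < M - 1 then
      (if (⟨k, α, ⟨v, h⟩⟩ : D.HaarIndex) ∈ s then 1 else 0) else 0 with hθ
    set c : ℕ → ℝ := fun j => ∑ v ∈ Finset.Ico 0 M, θ v * I.increment f k α v j with hc
    set F : X → ℝ := fun x => burkholderFun q (y + I.partialSum f s k (N + 1) x)
        (D.averageSum μ f (k + (N + 1 : ℕ)) x - (y + I.partialSum f s k (N + 1) x)) with hF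
    -- on a child of positive measure the first generation of the partial sum is constant
    have hchild : ∀ j : Fin M, μ (I.subcube k α j) ≠ 0 → ∀ x ∈ I.subcube k α j,
        F x = burkholderFun q (y + c j + I.partialSum f s (k + 1) N x)
          (D.averageSum μ f (k + 1 + N) x - (y + c j + I.partialSum f s (k + 1) N x)) := by
      intro j hj x hx
      have h1 : ∑ i ∈ s.filter (fun i => i.1 = k), I.haarTerm f i x = c j := by
        rw [I.sum_filter_generation f s (I.subcube_subset k α j hx), hc]
        simp only
        rw [Nat.Ico_zero_eq_range, ← I.sum_fin_mul_increment f θ j]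
        refine Finset.sum_congr rfl fun u _ => ?_
        have hu : (u : ℕ) < M - 1 := u.2
        have hθu : θ u = if (⟨k, α, u⟩ : D.HaarIndex) ∈ s then 1 else 0 := by
          simp only [hθ]
          rw [dif_pos hu]
        rw [hθu, I.haarTerm_eq_increment hμ (hf k α) u hj hx]
        split_ifs <;> simp
      simp only [hF]
      rw [I.partialSum_succ, h1, show k + ((N + 1 : ℕ) : ℤ) = k + 1 + N by push_cast; ring]
      simp only [add_assoc]
    have hpiece : ∀ j : Fin M, IntegrableOn F (I.subcube k α j) μ ∧
        ∫ x in I.subcube k α j, F x ∂μ ≤ μ.real (I.subcube k α j) *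
          burkholderFun q (y + c j) (⨍ x in I.subcube k α j, f x ∂μ - (y + c j)) := by
      intro j
      by_cases hj : μ (I.subcube k α j) = 0
      · rw [setIntegral_measure_zero _ hj, measureReal_def, hj]
        simp [IntegrableOn, Measure.restrict_eq_zero.2 hj]
      · obtain ⟨h1, h2⟩ := ih (k + 1) (I.enum k α j).1 (y + c j)
        refine ⟨h1.congr_fun (fun x hx => (hchild j hj x hx).symm)
          (I.measurableSet_subcube k α j), ?_⟩
        rw [setIntegral_congr_fun (I.measurableSet_subcube k α j) (hchild j hj)]
        exact h2
    refine ⟨?_, ?_⟩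
    · rw [← I.iUnion_subcube]
      exact integrableOn_finite_iUnion.2 fun j => (hpiece j).1
    · have hFsum : ∫ x in D.cube k α, F x ∂μ = ∑ j, ∫ x in I.subcube k α j, F x ∂μ := by
        rw [← I.iUnion_subcube]
        exact integral_iUnion_fintype (I.measurableSet_subcube k α) (I.disjoint_subcube k α)
          fun j => (hpiece j).1
      rw [hFsum]
      refine (Finset.sum_le_sum fun j _ => (hpiece j).2).trans ?_
      have hdiv : ∀ S : Set X, ⨍ x in S, f x ∂μ = (∫ x in S, f x ∂μ) / μ.real S := fun S => by
        rw [setAverage_eq, smul_eq_mul, div_eq_inv_mul]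
      have hav : ∀ j (h : j < M), ⨍ x in I.subcube k α ⟨j, h⟩, f x ∂μ
          = I.childIntegral f k α j / I.childMass k α j := fun j h => by
        rw [hdiv, childIntegral, childMass, dif_pos h, dif_pos h]
      have main := burkholderFun_tail_le hq (M := M) (w := I.childMass k α)
        (F := I.childIntegral f k α) (T := fun u => μ.real (I.tail k α u))
        (G := fun u => ∫ x in I.tail k α u, f x ∂μ) (θ := θ)
        (fun j => by unfold childMass; split_ifs <;> simp)
        (fun j hj => by
          unfold childMass at hj
          unfold childIntegral
          split_ifs at hj ⊢ with h
          · rw [measureReal_eq_zero_iff (measure_ne_top_of_subset (I.subcube_subset k α _)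
              (hμ k α))] at hj
            exact setIntegral_measure_zero _ hj
          · rfl)
        (I.measureReal_tail hμ k α) (I.setIntegral_tail (hf k α))
        (fun u => by simp only [hθ]; split_ifs <;> simp)
        (d := I.increment f k α)
        (fun v j h => by rw [increment, if_pos h])
        (fun v => by
          rw [increment, if_neg (lt_irrefl _), if_neg (lt_irrefl _), hdiv]
          congr 1
          split_ifs with h
          · exact hav v h
          · rw [childIntegral, dif_neg h, zero_div])
        (fun v j h => by
          rw [increment, if_neg (by omega), if_pos h, hdiv, hdiv])
        M 0 (zero_add M) y
      rw [I.tail_zero, ← hdiv] at main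
      refine le_trans (le_of_eq ?_) main
      rw [Nat.Ico_zero_eq_range, ← Fin.sum_univ_eq_sum_range (fun j => I.childMass k α j *
        burkholderFun q (y + ∑ v ∈ Finset.range M, θ v * I.increment f k α v j)
          (I.childIntegral f k α j / I.childMass k α j
            - (y + ∑ v ∈ Finset.range M, θ v * I.increment f k α v j)))]
      refine Finset.sum_congr rfl fun j _ => ?_
      have hmass : I.childMass k α j = μ.real (I.subcube k α j) := by
        rw [childMass, dif_pos j.2]
      rw [← hav j j.2, hc, hmass]
      simp only [Fin.eta, Nat.Ico_zero_eq_range]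

end ChildIndexing

end DyadicSystem

/-! ### Burkholder's inequality for the partial sums -/

namespace DyadicSystem

variable {X 𝕜 : Type*} [QuasiMetricSpace X] [MeasurableSpace X] [RCLike 𝕜]
  {D : DyadicSystem X} {μ : Measure X} {p : ℝ≥0∞} {f g : X → 𝕜}

namespace ChildIndexing

theorem measurable_haar (I : D.ChildIndexing μ) (k : ℤ) (α : D.A k)
    (u : Fin (D.numChildren k α - 1)) : Measurable (I.haar k α u) := by
  unfold haar
  by_cases h : μ (I.subcube k α ⟨u, by omega⟩) = 0
  · simp only [h, if_true]
    exact measurable_const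
  · simp only [h, if_false]
    exact ((measurable_const.indicator (I.measurableSet_subcube k α _)).const_mul _).sub
      ((measurable_const.indicator (I.measurableSet_tail k α _)).const_mul _)

theorem aestronglyMeasurable_sum_haarTerm (I : D.ChildIndexing μ) (f : X → 𝕜)
    (s : Finset D.HaarIndex) : AEStronglyMeasurable (fun x => ∑ i ∈ s, I.haarTerm f i x) μ := by
  have h : Measurable fun x => ∑ i ∈ s, I.haarTerm f i x :=
    Finset.measurable_fun_sum _ fun i _ =>
      (RCLike.measurable_ofReal.comp (I.measurable_haar i.1 i.2.1 i.2.2)).const_mul _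
  exact h.aestronglyMeasurable

theorem sum_haarTerm_sub (I : D.ChildIndexing μ) (hμ : ∀ k α, μ (D.cube k α) ≠ ∞) (hp1 : 1 ≤ p)
    (hf : MemLp f p μ) (hg : MemLp g p μ) (s : Finset D.HaarIndex) (x : X) :
    ∑ i ∈ s, I.haarTerm (fun y => f y - g y) i x
      = ∑ i ∈ s, I.haarTerm f i x - ∑ i ∈ s, I.haarTerm g i x := by
  rw [← Finset.sum_sub_distrib]
  exact Finset.sum_congr rfl fun i _ => I.haarTerm_sub hμ hp1 hf hg i x

/-- Burkholder's inequality for real functions. -/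
theorem exists_eLpNorm_sum_haarTerm_le_real (hp1 : 1 < p) (hp : p ≠ ∞) : ∃ C : ℝ≥0∞, C ≠ ∞ ∧
    ∀ (I : D.ChildIndexing μ) (_ : ∀ k α, μ (D.cube k α) ≠ ∞) (f : X → ℝ) (_ : MemLp f p μ)
      (n : ℤ) (s : Finset D.HaarIndex) (_ : ∀ i ∈ s, i.1 < n),
      eLpNorm (fun x => ∑ i ∈ s, I.haarTerm f i x) p μ
        ≤ C * eLpNorm (D.averageSum μ f n) p μ := by
  have hp0 : p ≠ 0 := (zero_lt_one.trans hp1).ne'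
  have hq : 1 < p.toReal := by
    rw [← ENNReal.toReal_one]; exact (ENNReal.toReal_lt_toReal ENNReal.one_ne_top hp).2 hp1
  set q := p.toReal with hqdef
  have hq0 : 0 < q := by linarith
  obtain ⟨A, B, hA, hB, hAB⟩ := exists_abs_rpow_le_burkholderFun hq
  refine ⟨ENNReal.ofReal B ^ (1 / q),
    ENNReal.rpow_ne_top_of_nonneg (by positivity) ENNReal.ofReal_ne_top,
    fun I hμ f hf n s hs => ?_⟩
  -- on the cubes of generation `m` the transform starts with `y = 0`
  obtain ⟨m, hmn, hm⟩ : ∃ m ≤ n, ∀ i ∈ s, m ≤ i.1 := by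
    obtain ⟨m, hm⟩ := (s.image fun i => i.1).bddBelow
    exact ⟨min m n, min_le_right _ _, fun i hi =>
      (min_le_left _ _).trans (hm (Finset.mem_coe.2 (Finset.mem_image_of_mem _ hi)))⟩
  obtain ⟨N, rfl⟩ : ∃ N : ℕ, n = m + N := ⟨(n - m).toNat, by omega⟩
  have hS : ∀ x, I.partialSum f s m N x = ∑ i ∈ s, I.haarTerm f i x := fun x => by
    rw [partialSum, Finset.filter_true_of_mem fun i hi => ⟨hm i hi, hs i hi⟩]
  have henorm : ∀ t : ℝ, ‖t‖ₑ ^ q = ENNReal.ofReal (|t| ^ q) := fun t => by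
    rw [← ofReal_norm, Real.norm_eq_abs, ENNReal.ofReal_rpow_of_nonneg (abs_nonneg t) hq0.le]
  have hpiece : ∀ α : D.A m, ∫⁻ x in D.cube m α, ‖∑ i ∈ s, I.haarTerm f i x‖ₑ ^ q ∂μ
      ≤ ENNReal.ofReal B * ∫⁻ x in D.cube m α, ‖D.averageSum μ f (m + N) x‖ₑ ^ q ∂μ := by
    intro α
    obtain ⟨h1, h2⟩ := I.setIntegral_burkholderFun_le hμ (integrableOn_cube hμ hp1.le hf) hq s N
      m α 0
    simp only [zero_add, hS, sub_zero] at h1 h2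
    replace h2 := h2.trans (mul_nonpos_of_nonneg_of_nonpos measureReal_nonneg
      (burkholderFun_zero_left_nonpos hq _))
    have h3 : IntegrableOn (fun x => |D.averageSum μ f (m + N) x| ^ q) (D.cube m α) μ :=
      ((memLp_averageSum hμ hp1.le hp hf (m + N)).integrable_norm_rpow hp0 hp).integrableOn
    set W : X → ℝ := fun x => burkholderFun q (∑ i ∈ s, I.haarTerm f i x)
      (D.averageSum μ f (m + N) x - ∑ i ∈ s, I.haarTerm f i x) with hW
    have hle : ∀ x, |∑ i ∈ s, I.haarTerm f i x| ^ q
        ≤ A * W x + B * |D.averageSum μ f (m + N) x| ^ q := fun x => by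
      have := hAB (∑ i ∈ s, I.haarTerm f i x)
        (D.averageSum μ f (m + N) x - ∑ i ∈ s, I.haarTerm f i x)
      rwa [add_sub_cancel] at this
    simp only [henorm]
    rw [← ofReal_integral_eq_lintegral_ofReal h3
      (ae_of_all _ fun x => Real.rpow_nonneg (abs_nonneg _) _), ← ENNReal.ofReal_mul hB]
    calc ∫⁻ x in D.cube m α, ENNReal.ofReal (|∑ i ∈ s, I.haarTerm f i x| ^ q) ∂μ
        ≤ ∫⁻ x in D.cube m α,
            ENNReal.ofReal (A * W x + B * |D.averageSum μ f (m + N) x| ^ q) ∂μ :=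
          lintegral_mono fun x => ENNReal.ofReal_le_ofReal (hle x)
      _ = ENNReal.ofReal (∫ x in D.cube m α,
            (A * W x + B * |D.averageSum μ f (m + N) x| ^ q) ∂μ) :=
          (ofReal_integral_eq_lintegral_ofReal ((h1.const_mul A).add (h3.const_mul B))
            (ae_of_all _ fun x => (Real.rpow_nonneg (abs_nonneg _) _).trans (hle x))).symm
      _ ≤ _ := by
          refine ENNReal.ofReal_le_ofReal ?_
          rw [integral_add (h1.const_mul A) (h3.const_mul B), integral_const_mul,
            integral_const_mul]
          have := mul_nonpos_of_nonneg_of_nonpos hA h2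
          linarith
  rw [eLpNorm_eq_lintegral_rpow_enorm_toReal hp0 hp, eLpNorm_eq_lintegral_rpow_enorm_toReal hp0 hp,
    ← ENNReal.mul_rpow_of_nonneg _ _ (by positivity)]
  gcongr ?_ ^ _
  rw [lintegral_eq_tsum_cube D μ m, lintegral_eq_tsum_cube D μ m, ← ENNReal.tsum_mul_left]
  exact ENNReal.tsum_le_tsum hpiece

/-- Burkholder's inequality: arbitrary finite partial sums of the Haar expansion are bounded in
`L^p`, with a constant that depends on `p` only. -/
theorem exists_eLpNorm_sum_haarTerm_le (𝕜 : Type*) [RCLike 𝕜] (hp1 : 1 < p) (hp : p ≠ ∞) :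
    ∃ C : ℝ≥0∞, C ≠ ∞ ∧
    ∀ (I : D.ChildIndexing μ) (_ : ∀ k α, μ (D.cube k α) ≠ ∞) (f : X → 𝕜) (_ : MemLp f p μ)
      (n : ℤ) (s : Finset D.HaarIndex) (_ : ∀ i ∈ s, i.1 < n),
      eLpNorm (fun x => ∑ i ∈ s, I.haarTerm f i x) p μ
        ≤ C * eLpNorm (D.averageSum μ f n) p μ := by
  obtain ⟨C, hC, h⟩ := exists_eLpNorm_sum_haarTerm_le_real (D := D) (μ := μ) hp1 hp
  refine ⟨C + C, ENNReal.add_ne_top.2 ⟨hC, hC⟩, fun I hμ f hf n s hs => ?_⟩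
  have hre := h I hμ _ hf.re n s hs
  have him := h I hμ _ hf.im n s hs
  have hmeas := fun f : X → ℝ => I.aestronglyMeasurable_sum_haarTerm f s
  calc eLpNorm (fun x => ∑ i ∈ s, I.haarTerm f i x) p μ
      ≤ eLpNorm (fun x => ‖∑ i ∈ s, I.haarTerm (fun y => RCLike.re (f y)) i x‖
          + ‖∑ i ∈ s, I.haarTerm (fun y => RCLike.im (f y)) i x‖) p μ := by
        refine eLpNorm_mono_real fun x => ?_
        simp only [I.haarTerm_re hμ hp1.le hf, I.haarTerm_im hμ hp1.le hf, ← map_sum,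
          Real.norm_eq_abs]
        refine (abs_norm _).symm.le.trans (abs_le_of_sq_le_sq ?_ (by positivity))
        rw [RCLike.norm_sq_eq_def, add_sq, sq_abs, sq_abs]
        have := mul_nonneg (abs_nonneg (RCLike.re (∑ i ∈ s, I.haarTerm f i x)))
          (abs_nonneg (RCLike.im (∑ i ∈ s, I.haarTerm f i x)))
        nlinarith
    _ ≤ eLpNorm (fun x => ‖∑ i ∈ s, I.haarTerm (fun y => RCLike.re (f y)) i x‖) p μ
          + eLpNorm (fun x => ‖∑ i ∈ s, I.haarTerm (fun y => RCLike.im (f y)) i x‖) p μ :=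
        eLpNorm_add_le (hmeas _).norm (hmeas _).norm hp1.le
    _ ≤ C * eLpNorm (D.averageSum μ f n) p μ + C * eLpNorm (D.averageSum μ f n) p μ := by
        rw [eLpNorm_norm, eLpNorm_norm]
        refine add_le_add (hre.trans ?_) (him.trans ?_)
        · gcongr
          refine eLpNorm_mono fun x => ?_
          rw [averageSum_re hμ hp1.le hf]
          exact RCLike.norm_re_le_norm _
        · gcongr
          refine eLpNorm_mono fun x => ?_
          rw [averageSum_im hμ hp1.le hf]
          exact RCLike.norm_im_le_norm _
    _ = (C + C) * eLpNorm (D.averageSum μ f n) p μ := (add_mul _ _ _).symm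

end ChildIndexing

end DyadicSystem

/-! ### Convergence of the Haar expansion -/

namespace DyadicSystem

variable {X 𝕜 : Type*} [QuasiMetricSpace X] [MeasurableSpace X] [RCLike 𝕜]
  {D : DyadicSystem X} {μ : Measure X} {p : ℝ≥0∞} {f g : X → 𝕜} {x₀ : X}

namespace ChildIndexing

/-- The average `A_n f` is constant on the cubes of generation at least `n`, so its Haar terms there
vanish and `f` may be replaced by `f - A_n f`. -/
theorem eLpNorm_sum_haarTerm_le_of_forall_ge (I : D.ChildIndexing μ)
    (hμ : ∀ k α, μ (D.cube k α) ≠ ∞) (hp1 : 1 ≤ p) (hp : p ≠ ∞) {C : ℝ≥0∞}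
    (hC : ∀ g : X → 𝕜, MemLp g p μ → ∀ (n : ℤ) (s : Finset D.HaarIndex), (∀ i ∈ s, i.1 < n) →
      eLpNorm (fun x => ∑ i ∈ s, I.haarTerm g i x) p μ ≤ C * eLpNorm (D.averageSum μ g n) p μ)
    (hf : MemLp f p μ) {n : ℤ} {s : Finset D.HaarIndex} (hs : ∀ i ∈ s, n ≤ i.1) :
    eLpNorm (fun x => ∑ i ∈ s, I.haarTerm f i x) p μ
      ≤ C * eLpNorm (fun x => D.averageSum μ f n x - f x) p μ := by
  have hA := memLp_averageSum hμ hp1 hp hf n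
  have hsub : MemLp (fun x => f x - D.averageSum μ f n x) p μ := hf.sub hA
  obtain ⟨N, hN⟩ : ∃ N : ℤ, ∀ i ∈ s, i.1 < N := by
    obtain ⟨N, hN⟩ := (s.image fun i => i.1).bddAbove
    exact ⟨N + 1, fun i hi =>
      Int.lt_add_one_of_le (hN (Finset.mem_coe.2 (Finset.mem_image_of_mem _ hi)))⟩
  have e : ∀ x, ∑ i ∈ s, I.haarTerm f i x
      = ∑ i ∈ s, I.haarTerm (fun y => f y - D.averageSum μ f n y) i x := by
    intro x
    refine Finset.sum_congr rfl fun i hi => ?_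
    rw [I.haarTerm_sub hμ hp1 hf hA, I.haarTerm_eq_zero_of_const hμ (f := D.averageSum μ f n) i
      (c := D.averageSum μ f n (D.center i.1 i.2.1)), sub_zero]
    intro y hy
    have hc := D.mem_cube_idx n (D.center i.1 i.2.1)
    rw [averageSum_of_mem f hc, averageSum_of_mem f
      (cube_subset_of_mem (hs i hi) hc (D.center_mem_cube i.1 i.2.1) hy)]
  simp only [e]
  refine (hC _ hsub N s hN).trans ?_
  gcongr
  exact (eLpNorm_averageSum_le hμ hp1 hp hsub.1 N).trans (eLpNorm_sub_comm f _ p μ).le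

/-- Constants have no Haar terms, so `f` may be replaced by `f - m_X(f)`, whose averages over
the cubes of positive measure are `A_m f - m_X(f)`. -/
theorem eLpNorm_sum_haarTerm_le_of_forall_lt (I : D.ChildIndexing μ)
    (hμ : ∀ k α, μ (D.cube k α) ≠ ∞) (hp1 : 1 ≤ p) {C : ℝ≥0∞}
    (hC : ∀ g : X → 𝕜, MemLp g p μ → ∀ (n : ℤ) (s : Finset D.HaarIndex), (∀ i ∈ s, i.1 < n) →
      eLpNorm (fun x => ∑ i ∈ s, I.haarTerm g i x) p μ ≤ C * eLpNorm (D.averageSum μ g n) p μ)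
    (hf : MemLp f p μ) {m : ℤ} {s : Finset D.HaarIndex} (hs : ∀ i ∈ s, i.1 < m) :
    eLpNorm (fun x => ∑ i ∈ s, I.haarTerm f i x) p μ
      ≤ C * eLpNorm (fun x => D.averageSum μ f m x - globalMean μ f) p μ := by
  have hc := memLp_globalMean (p := p) (μ := μ) f
  have e : ∀ x, ∑ i ∈ s, I.haarTerm f i x
      = ∑ i ∈ s, I.haarTerm (fun y => f y - globalMean μ f) i x := by
    intro x
    refine Finset.sum_congr rfl fun i _ => ?_
    rw [I.haarTerm_sub hμ hp1 hf hc,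
      I.haarTerm_eq_zero_of_const hμ (f := fun _ => globalMean μ f) i (fun _ _ => rfl), sub_zero]
  simp only [e]
  have hsub : MemLp (fun y => f y - globalMean μ f) p μ := hf.sub hc
  refine (hC _ hsub m s hs).trans (le_of_eq ?_)
  congr 1
  refine eLpNorm_congr_ae ?_
  filter_upwards [ae_measure_cube_idx_ne_zero D μ] with x hx
  rw [averageSum_sub hμ hp1 hf hc]
  congr 1
  rw [averageSum_eq]
  have : IsFiniteMeasure (μ.restrict (D.cube m (D.idx m x))) :=
    isFiniteMeasure_restrict.2 (hμ _ _)
  exact setAverage_const (hx m) (hμ _ _) _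

/-- For a function supported in a cube, finitely many Haar functions of the generations
`m, …, n - 1` suffice to represent the difference of the averages. -/
theorem sum_haarTerm_indicator (I : D.ChildIndexing μ) (hμ : ∀ k α, μ (D.cube k α) ≠ ∞)
    (hp1 : 1 ≤ p) (hf : MemLp f p μ) {m₀ m n : ℤ} (hm₀ : m₀ ≤ m) (hmn : m ≤ n) {κ : D.A m₀}
    {s : Finset D.HaarIndex} (hs : ∀ i ∈ s, m ≤ i.1 ∧ i.1 < n)
    (hκ : ∀ i : D.HaarIndex, m ≤ i.1 → i.1 < n → D.cube i.1 i.2.1 ⊆ D.cube m₀ κ → i ∈ s)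
    {x : X} (hx : ∀ k : ℤ, μ (D.cube k (D.idx k x)) ≠ 0) :
    ∑ i ∈ s, I.haarTerm ((D.cube m₀ κ).indicator f) i x
      = D.averageSum μ ((D.cube m₀ κ).indicator f) n x
        - D.averageSum μ ((D.cube m₀ κ).indicator f) m x := by
  classical
  have hf₁ : MemLp ((D.cube m₀ κ).indicator f) p μ := hf.indicator (D.measurableSet_cube m₀ κ)
  rw [← I.sum_Ico_generationSum hμ hp1 hf₁ hx hmn,
    ← Finset.sum_fiberwise_of_maps_to (s := s) (t := Finset.Ico m n) (g := fun i => i.1)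
      (fun i hi => Finset.mem_Ico.2 (hs i hi))]
  refine Finset.sum_congr rfl fun k hk => ?_
  obtain ⟨hmk, hkn⟩ := Finset.mem_Ico.1 hk
  rw [I.sum_filter_generation _ s (D.mem_cube_idx k x), generationSum_eq]
  refine Finset.sum_congr rfl fun u _ => ?_
  split_ifs with h
  · rfl
  · refine (I.haarTerm_eq_zero_of_const hμ _ (c := 0) (fun y hy => ?_) x).symm
    have hd := (D.nested m₀ k κ (D.idx k x) (hm₀.trans hmk)).resolve_left
      fun hsub => h (hκ ⟨k, D.idx k x, u⟩ hmk hkn hsub)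
    exact Set.indicator_of_notMem (Set.disjoint_right.1 hd hy) f

theorem finite_haarIndex_cube_subset (D : DyadicSystem X) {m₀ m : ℤ} (hm₀ : m₀ ≤ m) (n : ℤ)
    (κ : D.A m₀) :
    {i : D.HaarIndex | (m ≤ i.1 ∧ i.1 < n) ∧ D.cube i.1 i.2.1 ⊆ D.cube m₀ κ}.Finite := by
  have h : (⋃ k ∈ Set.Ico m n, ⋃ α ∈ {α : D.A k | D.cube k α ⊆ D.cube m₀ κ},
      Set.range fun u => (⟨k, α, u⟩ : D.HaarIndex)).Finite := by
    refine (Set.finite_Ico m n).biUnion fun k hk => ?_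
    exact (D.finite_cube_subset (hm₀.trans hk.1) κ).biUnion fun α _ => Set.finite_range _
  refine h.subset ?_
  rintro ⟨k, α, u⟩ ⟨hk, hα⟩
  exact Set.mem_biUnion (x := k) hk (Set.mem_biUnion (x := α) hα ⟨u, rfl⟩)

/-- Unconditional convergence in norm of the Haar expansion over finitely many generations. -/
theorem exists_finset_eLpNorm_averageSum_sub_le (I : D.ChildIndexing μ)
    (hμ : ∀ k α, μ (D.cube k α) ≠ ∞) (hx₀ : ∀ k : ℤ, ∃ α : D.A k, D.center k α = x₀)
    (hp1 : 1 ≤ p) (hp : p ≠ ∞) {C : ℝ≥0∞} (hCtop : C ≠ ∞)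
    (hC : ∀ g : X → 𝕜, MemLp g p μ → ∀ (n : ℤ) (s : Finset D.HaarIndex), (∀ i ∈ s, i.1 < n) →
      eLpNorm (fun x => ∑ i ∈ s, I.haarTerm g i x) p μ ≤ C * eLpNorm (D.averageSum μ g n) p μ)
    (hf : MemLp f p μ) {m n : ℤ} (hmn : m ≤ n) {ε : ℝ≥0∞} (hε : 0 < ε) :
    ∃ s₀ : Finset D.HaarIndex, (∀ i ∈ s₀, m ≤ i.1 ∧ i.1 < n) ∧
      ∀ s : Finset D.HaarIndex, s₀ ⊆ s → (∀ i ∈ s, m ≤ i.1 ∧ i.1 < n) →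
        eLpNorm (fun x => D.averageSum μ f n x - D.averageSum μ f m x
          - ∑ i ∈ s, I.haarTerm f i x) p μ ≤ ε := by
  have hp0 : p ≠ 0 := (zero_lt_one.trans_le hp1).ne'
  have hK : 1 + 1 + C ≠ ∞ := by simp [hCtop]
  have hδ : 0 < ε / (1 + 1 + C) := ENNReal.div_pos hε.ne' hK
  -- `f₁` is `f` on a large cube; the rest `f₂` of `f` contributes at most three small terms
  obtain ⟨m₀, hm₀, hfar⟩ := exists_eLpNorm_sub_indicator_cube_le hx₀ hp0 hp hf hδ m
  set κ := D.idx m₀ x₀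
  set f₁ : X → 𝕜 := (D.cube m₀ κ).indicator f with hf₁
  set f₂ : X → 𝕜 := fun x => f x - f₁ x with hf₂
  have hf₁p : MemLp f₁ p μ := hf.indicator (D.measurableSet_cube m₀ κ)
  have hf₂p : MemLp f₂ p μ := hf.sub hf₁p
  refine ⟨(finite_haarIndex_cube_subset D hm₀ n κ).toFinset, fun i hi => ?_, fun s hs₀ hs => ?_⟩
  · exact ((Set.Finite.mem_toFinset _).1 hi).1
  have hsum := I.aestronglyMeasurable_sum_haarTerm f₂ s
  have hAm : ∀ k, AEStronglyMeasurable (D.averageSum μ f₂ k) μ :=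
    fun k => aestronglyMeasurable_averageSum f₂ k
  have hAle : ∀ k, eLpNorm (D.averageSum μ f₂ k) p μ ≤ ε / (1 + 1 + C) := fun k =>
    (eLpNorm_averageSum_le hμ hp1 hp hf₂p.1 k).trans hfar
  calc eLpNorm (fun x => D.averageSum μ f n x - D.averageSum μ f m x
          - ∑ i ∈ s, I.haarTerm f i x) p μ
      = eLpNorm ((D.averageSum μ f₂ n - D.averageSum μ f₂ m)
          - fun x => ∑ i ∈ s, I.haarTerm f₂ i x) p μ := by
        refine eLpNorm_congr_ae ?_
        filter_upwards [ae_measure_cube_idx_ne_zero D μ] with x hx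
        have h := I.sum_haarTerm_indicator hμ hp1 hf hm₀ hmn hs
          (fun i h1 h2 h3 => hs₀ ((Set.Finite.mem_toFinset _).2 ⟨⟨h1, h2⟩, h3⟩)) hx
        simp only [Pi.sub_apply]
        rw [I.sum_haarTerm_sub hμ hp1 hf hf₁p, averageSum_sub hμ hp1 hf hf₁p,
          averageSum_sub hμ hp1 hf hf₁p, h]
        ring
    _ ≤ eLpNorm (D.averageSum μ f₂ n) p μ + eLpNorm (D.averageSum μ f₂ m) p μ
          + eLpNorm (fun x => ∑ i ∈ s, I.haarTerm f₂ i x) p μ := by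
        refine (eLpNorm_sub_le ((hAm n).sub (hAm m)) hsum hp1).trans ?_
        gcongr
        exact eLpNorm_sub_le (hAm n) (hAm m) hp1
    _ ≤ ε / (1 + 1 + C) + ε / (1 + 1 + C) + C * (ε / (1 + 1 + C)) := by
        refine add_le_add (add_le_add (hAle n) (hAle m)) ?_
        refine (hC f₂ hf₂p n s fun i hi => (hs i hi).2).trans ?_
        gcongr
        exact hAle n
    _ = (1 + 1 + C) * (ε / (1 + 1 + C)) := by ring
    _ ≤ ε := ENNReal.mul_div_le

/-- The expansion from generation `m` on converges unconditionally in norm. -/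
theorem tendsto_eLpNorm_sub_sum_haarTerm_ge [BorelSpace X] (I : D.ChildIndexing μ)
    (hμ : ∀ k α, μ (D.cube k α) ≠ ∞) (hx₀ : ∀ k : ℤ, ∃ α : D.A k, D.center k α = x₀)
    (hp1 : 1 < p) (hp : p ≠ ∞) (hf : MemLp f p μ) (m : ℤ) :
    Tendsto (fun s : Finset {i : D.HaarIndex // m ≤ i.1} =>
      eLpNorm (fun x => f x - (∑ i ∈ s, I.haarTerm f i.1 x + D.averageSum μ f m x)) p μ)
      atTop (𝓝 0) := by
  classical
  obtain ⟨C, hCtop, hC'⟩ := exists_eLpNorm_sum_haarTerm_le (D := D) (μ := μ) 𝕜 hp1 hp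
  have hC := hC' I hμ
  refine ENNReal.tendsto_nhds_zero.2 fun ε hε => ?_
  have hK : 1 + 1 + C ≠ ∞ := by simp [hCtop]
  have hδ : 0 < ε / (1 + 1 + C) := ENNReal.div_pos hε.ne' hK
  obtain ⟨n, hn, hmn⟩ := ((ENNReal.tendsto_nhds_zero.1
    (tendsto_eLpNorm_averageSum_atTop hμ hx₀ hp1.le hp hf) _ hδ).and
      (eventually_ge_atTop m)).exists
  obtain ⟨s₀, hs₀, hs₀'⟩ :=
    I.exists_finset_eLpNorm_averageSum_sub_le hμ hx₀ hp1.le hp hCtop hC hf hmn hδ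
  filter_upwards [eventually_ge_atTop (s₀.subtype fun i => m ≤ i.1)] with s' hs'
  set s : Finset D.HaarIndex := s'.map (Function.Embedding.subtype _) with hs
  have hsm : ∀ i ∈ s, m ≤ i.1 := by
    intro i hi
    obtain ⟨j, -, rfl⟩ := Finset.mem_map.1 hi
    exact j.2
  have hsub : s₀ ⊆ s.filter fun i => i.1 < n := fun i hi => by
    refine Finset.mem_filter.2 ⟨Finset.mem_map.2 ⟨⟨i, (hs₀ i hi).1⟩, hs' ?_, rfl⟩, (hs₀ i hi).2⟩
    exact Finset.mem_subtype.2 hi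
  have hmid := hs₀' _ hsub fun i hi =>
    ⟨hsm i (Finset.mem_filter.1 hi).1, (Finset.mem_filter.1 hi).2⟩
  have hhigh := I.eLpNorm_sum_haarTerm_le_of_forall_ge hμ hp1.le hp hC hf (n := n)
    (s := s.filter fun i => ¬ i.1 < n) (fun i hi => not_lt.1 (Finset.mem_filter.1 hi).2)
  have hA : ∀ k, AEStronglyMeasurable (D.averageSum μ f k) μ :=
    fun k => aestronglyMeasurable_averageSum f k
  have hS : ∀ t : Finset D.HaarIndex,
      AEStronglyMeasurable (fun x => ∑ i ∈ t, I.haarTerm f i x) μ :=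
    fun t => I.aestronglyMeasurable_sum_haarTerm f t
  calc eLpNorm (fun x => f x - (∑ i ∈ s', I.haarTerm f i.1 x + D.averageSum μ f m x)) p μ
      = eLpNorm (((fun x => D.averageSum μ f n x - D.averageSum μ f m x
            - ∑ i ∈ s.filter (fun i => i.1 < n), I.haarTerm f i x)
          - fun x => D.averageSum μ f n x - f x)
          - fun x => ∑ i ∈ s.filter (fun i => ¬ i.1 < n), I.haarTerm f i x) p μ := by
        congr 1
        ext x
        have e : ∑ i ∈ s', I.haarTerm f i.1 x = ∑ i ∈ s, I.haarTerm f i x := by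
          rw [hs, Finset.sum_map]; rfl
        simp only [Pi.sub_apply]
        rw [e, ← Finset.sum_filter_add_sum_filter_not s (fun i => i.1 < n)]
        ring
    _ ≤ ε / (1 + 1 + C) + ε / (1 + 1 + C) + C * (ε / (1 + 1 + C)) := by
        refine (eLpNorm_sub_le ((((hA n).sub (hA m)).sub (hS _)).sub ((hA n).sub hf.1))
          (hS _) hp1.le).trans (add_le_add ?_ ?_)
        · exact (eLpNorm_sub_le (((hA n).sub (hA m)).sub (hS _)) ((hA n).sub hf.1)
            hp1.le).trans (add_le_add hmid hn)
        · refine hhigh.trans ?_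
          gcongr
    _ = (1 + 1 + C) * (ε / (1 + 1 + C)) := by ring
    _ ≤ ε := ENNReal.mul_div_le

/-- The full expansion converges unconditionally in norm. -/
theorem tendsto_eLpNorm_sub_sum_haarTerm [BorelSpace X] (I : D.ChildIndexing μ)
    (hμ : ∀ k α, μ (D.cube k α) ≠ ∞) (hx₀ : ∀ k : ℤ, ∃ α : D.A k, D.center k α = x₀)
    (hp1 : 1 < p) (hp : p ≠ ∞) (hf : MemLp f p μ) :
    Tendsto (fun s : Finset D.HaarIndex =>
      eLpNorm (fun x => f x - (globalMean μ f + ∑ i ∈ s, I.haarTerm f i x)) p μ)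
      atTop (𝓝 0) := by
  classical
  obtain ⟨C, hCtop, hC'⟩ := exists_eLpNorm_sum_haarTerm_le (D := D) (μ := μ) 𝕜 hp1 hp
  have hC := hC' I hμ
  refine ENNReal.tendsto_nhds_zero.2 fun ε hε => ?_
  have hK : 1 + C ≠ ∞ := by simp [hCtop]
  have hε2 := ENNReal.half_pos hε.ne'
  have hδ : 0 < ε / 2 / (1 + C) := ENNReal.div_pos hε2.ne' hK
  obtain ⟨m, hm⟩ := (ENNReal.tendsto_nhds_zero.1
    (tendsto_eLpNorm_averageSum_atBot hμ hx₀ hp1 hp hf) _ hδ).exists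
  -- the generations from `m` on are covered by the expansion from a fixed generation on
  have hge := (Filter.eventually_atTop.1 (ENNReal.tendsto_nhds_zero.1
    (I.tendsto_eLpNorm_sub_sum_haarTerm_ge hμ hx₀ hp1 hp hf m) _ hε2))
  obtain ⟨s₀, hs₀⟩ := hge
  filter_upwards [eventually_ge_atTop (s₀.map (Function.Embedding.subtype _))] with s hs
  have hmid := hs₀ (s.subtype fun i => m ≤ i.1) fun i hi =>
    Finset.mem_subtype.2 (hs (Finset.mem_map_of_mem _ hi))
  have hlow := I.eLpNorm_sum_haarTerm_le_of_forall_lt hμ hp1.le hC hf (m := m)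
    (s := s.filter fun i => ¬ m ≤ i.1) (fun i hi => not_le.1 (Finset.mem_filter.1 hi).2)
  have hA : AEStronglyMeasurable (D.averageSum μ f m) μ := aestronglyMeasurable_averageSum f m
  have hS : ∀ t : Finset D.HaarIndex,
      AEStronglyMeasurable (fun x => ∑ i ∈ t, I.haarTerm f i x) μ :=
    fun t => I.aestronglyMeasurable_sum_haarTerm f t
  have e : ∀ x, ∑ i ∈ s.subtype (fun i => m ≤ i.1), I.haarTerm f i.1 x
      = ∑ i ∈ s.filter (fun i => m ≤ i.1), I.haarTerm f i x := fun x => by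
    rw [← Finset.subtype_map, Finset.sum_map]; rfl
  simp only [e] at hmid
  have hc := (memLp_globalMean (p := p) (μ := μ) f).1
  calc eLpNorm (fun x => f x - (globalMean μ f + ∑ i ∈ s, I.haarTerm f i x)) p μ
      = eLpNorm ((fun x => f x
            - (∑ i ∈ s.filter (fun i => m ≤ i.1), I.haarTerm f i x + D.averageSum μ f m x))
          + ((fun x => D.averageSum μ f m x - globalMean μ f)
            - fun x => ∑ i ∈ s.filter (fun i => ¬ m ≤ i.1), I.haarTerm f i x)) p μ := by
        congr 1
        ext x
        simp only [Pi.sub_apply, Pi.add_apply]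
        rw [← Finset.sum_filter_add_sum_filter_not s (fun i => m ≤ i.1)]
        ring
    _ ≤ ε / 2 + (ε / 2 / (1 + C) + C * (ε / 2 / (1 + C))) := by
        refine (eLpNorm_add_le (hf.1.sub ((hS _).add hA)) ((hA.sub hc).sub (hS _))
          hp1.le).trans (add_le_add hmid ?_)
        refine (eLpNorm_sub_le (hA.sub hc) (hS _) hp1.le).trans (add_le_add hm ?_)
        refine hlow.trans ?_
        gcongr
    _ = ε / 2 + (1 + C) * (ε / 2 / (1 + C)) := by ring
    _ ≤ ε / 2 + ε / 2 := by gcongr; exact ENNReal.mul_div_le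
    _ = ε := ENNReal.add_halves ε

end ChildIndexing

end DyadicSystem

end

theorem mainTheorem3 {X : Type*} [QuasiMetricSpace X] [MeasurableSpace X] [BorelSpace X]
    (hX : GeometricallyDoubling X) (μ : Measure X)
    (hμ : ∀ (x : X) (r : ℝ), μ (qball x r) < ∞)
    (D : DyadicSystem X) (hD : D.HasDistinguishedCenter) (I : D.ChildIndexing μ)
    {𝕜 : Type*} [RCLike 𝕜] (p : ℝ≥0∞) (hp1 : 1 < p) (hp : p ≠ ∞)
    (f : X → 𝕜) (hf : MemLp f p μ) :
    -- the full expansion: unconditional convergence in the norm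
    Tendsto (fun s : Finset D.HaarIndex =>
        eLpNorm (fun x => f x - (globalMean μ f + ∑ i ∈ s, I.haarTerm f i x)) p μ)
      atTop (𝓝 0) ∧
    -- the full expansion: convergence almost everywhere, both ends of the range of generations
    -- tending to infinity independently
    (∀ᵐ x ∂μ, Tendsto (fun q : ℤ × ℤ =>
        globalMean μ f + ∑ k ∈ Finset.Ico q.1 q.2, I.generationSum f k x)
      (atBot ×ˢ atTop) (𝓝 (f x))) ∧
    -- the expansion from a fixed generation on: unconditional convergence in the norm
    (∀ m : ℤ, Tendsto (fun s : Finset {i : D.HaarIndex // m ≤ i.1} =>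
        eLpNorm (fun x => f x - (∑ i ∈ s, I.haarTerm f i.1 x + D.averageSum μ f m x)) p μ)
      atTop (𝓝 0)) ∧
    -- the expansion from a fixed generation on: convergence almost everywhere
    (∀ m : ℤ, ∀ᵐ x ∂μ, Tendsto (fun n : ℤ =>
        ∑ k ∈ Finset.Ico m n, I.generationSum f k x + D.averageSum μ f m x)
      atTop (𝓝 (f x))) ∧
    -- the averages over the cubes of generation `m`, at every point and in the norm
    (∀ x : X, Tendsto (fun m : ℤ => D.averageSum μ f m x) atBot (𝓝 (globalMean μ f))) ∧
    Tendsto (fun m : ℤ => eLpNorm (fun x => D.averageSum μ f m x - globalMean μ f) p μ)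
      atBot (𝓝 0) := by
  have hμ' : ∀ k α, μ (D.cube k α) ≠ ∞ := fun k α =>
    ((measure_mono (D.cube_subset_qball k α)).trans_lt (hμ _ _)).ne
  obtain ⟨x₀, hx₀⟩ := hD
  have hae := DyadicSystem.ae_measure_cube_idx_ne_zero D μ
  have htop := DyadicSystem.ae_tendsto_averageSum_atTop hμ' hp1.le hp hf
  have hbot := DyadicSystem.tendsto_averageSum_atBot hμ' hx₀ hp1.le hp hf
  refine ⟨I.tendsto_eLpNorm_sub_sum_haarTerm hμ' hx₀ hp1 hp hf, ?_,
    I.tendsto_eLpNorm_sub_sum_haarTerm_ge hμ' hx₀ hp1 hp hf, fun m => ?_, hbot,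
    DyadicSystem.tendsto_eLpNorm_averageSum_atBot hμ' hx₀ hp1 hp hf⟩
  · filter_upwards [hae, htop] with x hx hx'
    have h := ((hx'.comp tendsto_snd).sub ((hbot x).comp tendsto_fst)).const_add (globalMean μ f)
    rw [add_sub_cancel] at h
    refine h.congr' ?_
    filter_upwards [(eventually_le_atBot (0 : ℤ)).prod_mk (eventually_ge_atTop (0 : ℤ))]
      with q hq
    rw [I.sum_Ico_generationSum hμ' hp1.le hf hx (hq.1.trans hq.2)]
    rfl
  · filter_upwards [hae, htop] with x hx hx'
    refine hx'.congr' ?_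
    filter_upwards [eventually_ge_atTop m] with n hn
    rw [I.sum_Ico_generationSum hμ' hp1.le hf hx hn, sub_add_cancel]
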